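/- Let $G=\mathrm{GL}_3(\mathbb R)$ and let $H=\mathrm{GL}_2(\mathbb R)$ be embedded in $G$ by $h\mapsto \mathrm{diag}(h,1)$; let $P_G,P_H$ be the subgroups of invertible upper triangular matrices. For $x\in\mathbb R^\times$, $\varepsilon\in\mathbb Z/2\mathbb Z$, $s\in\mathbb C$ put $|x|^s_\varepsilon=\mathrm{sgn}(x)^\varepsilon|x|^s$. For $(\xi,\lambda)\in(\mathbb Z/2\mathbb Z)^3\times\mathbb C^3$ let $\pi_{\xi,\lambda}$ be the left regular representation of $G$ on the space of $f\in C^\infty(G)$ with $$f(gp)=|p_{11}|_{\xi_1}^{-\lambda_1-1}\,|p_{22}|_{\xi_2}^{-\lambda_2}\,|p_{33}|_{\xi_3}^{-\lambda_3+1}f(g)\qquad(g\in G,\ p\in P_G),$$ and for $(\eta,\nu)\in(\mathbb Z/2\mathbb Z)^2\times\mathbb C^2$ let $\tau_{\eta,\nu}$ be the left regular representation of $H$ on the space of $f\in C^\infty(H)$ with $f(hp)=|p_{11}|_{\eta_1}^{-\nu_1-\frac12}|p_{22}|_{\eta_2}^{-\nu_2+\frac12}f(h)$ for $h\in H$, $p\in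 P_H$. Let $\mathrm{DSBO}_2(\pi_{\xi,\lambda},\tau_{\eta,\nu})$ be the space of $H$-intertwining linear maps $T:\pi_{\xi,\lambda}\to\tau_{\eta,\nu}$ that are differential operators along $p_2:H/P_H\to G/P_G$, $hP_H\mapsto hP_G$, i.e. satisfy $p_2(\operatorname{supp}Tf)\subset\operatorname{supp}f$ for all $f\in\pi_{\xi,\lambda}$, where $f$ and $Tf$ are regarded as sections of line bundles over $G/P_G$ and $H/P_H$. (The corresponding base point is $x_2=I_3$.) Put $$n_1=\nu_1-\lambda_1-\tfrac12,\qquad n_2=\nu_1+\nu_2-\lambda_1-\lambda_2-1 .$$ 1. Suppose that $n_1,n_2\in\mathbb N=\{0,1,2,\dots\}$, that $n_1\le n_2$ or there is an integer $0\le k_0\le n_2$ with $\lambda_1-\lambda_2+n_1-n_2+k_0=0$, and that $\eta_1=\xi_1+n_1$ and $\eta_2=\xi_2+n_1+n_2$ in $\mathbb Z/2\mathbb Z$. Then $\dim \mathrm{DSBO}_2(\pi_{\xi,\lambda},\tau_{\eta,\nu})=1$, and a basis is given by the operator $Tf(h)=\langle K, f(h\,\bar n(\cdot))\rangle$ with the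 distribution kernel $$K=\sum_{j=0}^{\min(n_1,n_2)}\frac{(-1)^j(-n_1)_j\,(\lambda_1-\lambda_2+n_1-n_2)_j}{j!}\,\delta^{(n_1-j)}(x)\,\delta^{(n_2-j)}(y)\,\delta^{(j)}(z),$$ where $(a)_j=a(a+1)\cdots(a+j-1)$, $\bar n(x,y,z)=\begin{pmatrix}1&0&0\\x&1&0\\z&y&1\end{pmatrix}$, and $\langle\delta^{(a)}(x)\delta^{(b)}(y)\delta^{(c)}(z),\varphi\rangle=(-1)^{a+b+c}(\partial_x^a\partial_y^b\partial_z^c\varphi)(0,0,0)$. 2. In all other cases $\mathrm{DSBO}_2(\pi_{\xi,\lambda},\tau_{\eta,\nu})=0$. -/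

import Mathlib

open scoped ContDiff

noncomputable section

namespace GLBranching

/-! ### Principal series of `GL n ℝ` -/

/-- The function `|x|_ε^s = sgn(x)^ε |x|^s` of `x ∈ ℝˣ`, for `ε ∈ ℤ/2ℤ` and `s ∈ ℂ`. -/
def signedPow (ε : ZMod 2) (s : ℂ) (x : ℝ) : ℂ :=
  (((SignType.sign x : ℝ) : ℂ)) ^ ε.val * ((|x| : ℝ) : ℂ) ^ s

/-- The `i`-th coordinate of `ρ = ½ (n-1, n-3, …, 3-n, 1-n)`. -/
def rho (n : ℕ) (i : Fin n) : ℂ := ((n : ℂ) - 1 - 2 * ((i : ℕ) : ℂ)) / 2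

/-- The minimal parabolic subgroup consists of the invertible upper triangular matrices. -/
def IsUpper {n : ℕ} (p : GL (Fin n) ℝ) : Prop :=
  ∀ i j : Fin n, j < i → (p : Matrix (Fin n) (Fin n) ℝ) i j = 0

section Smooth
open scoped Matrix.Norms.Elementwise

/-- Smoothness of a complex function on `GL n ℝ`, seen as the open set of invertible matrices in
the vector space of all real `n × n` matrices. -/
def IsSmooth {n : ℕ} (f : GL (Fin n) ℝ → ℂ) : Prop :=
  ∃ F : Matrix (Fin n) (Fin n) ℝ → ℂ,
    ContDiffOn ℝ ∞ F {A | IsUnit A} ∧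
      ∀ g : GL (Fin n) ℝ, F (g : Matrix (Fin n) (Fin n) ℝ) = f g

theorem isSmooth_zero {n : ℕ} : IsSmooth (0 : GL (Fin n) ℝ → ℂ) :=
  ⟨0, contDiffOn_const, fun _ => rfl⟩

theorem IsSmooth.add {n : ℕ} {f₁ f₂ : GL (Fin n) ℝ → ℂ} (h₁ : IsSmooth f₁) (h₂ : IsSmooth f₂) :
    IsSmooth (f₁ + f₂) := by
  obtain ⟨F₁, c₁, e₁⟩ := h₁
  obtain ⟨F₂, c₂, e₂⟩ := h₂
  exact ⟨F₁ + F₂, c₁.add c₂, fun g => by simp [e₁, e₂]⟩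

theorem IsSmooth.const_smul {n : ℕ} {f : GL (Fin n) ℝ → ℂ} (c : ℂ) (h : IsSmooth f) :
    IsSmooth (c • f) := by
  obtain ⟨F, cF, e⟩ := h
  exact ⟨c • F, cF.const_smul c, fun g => by simp [e]⟩

theorem IsSmooth.leftTranslate {n : ℕ} {f : GL (Fin n) ℝ → ℂ} (h : IsSmooth f)
    (a : GL (Fin n) ℝ) : IsSmooth (fun g => f (a * g)) := by
  obtain ⟨F, cF, e⟩ := h
  refine ⟨fun A => F ((a : Matrix (Fin n) (Fin n) ℝ) * A), ?_, fun g => ?_⟩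
  · refine cF.comp (t := {A | IsUnit A}) ?_ ?_
    · exact (LinearMap.toContinuousLinearMap
        (LinearMap.mulLeft ℝ (a : Matrix (Fin n) (Fin n) ℝ))).contDiff.contDiffOn
    · intro A hA
      exact a.isUnit.mul hA
  · change _ = f (a * g)
    rw [← e]; rfl

end Smooth

/-- The space of the principal series representation `Ind_P^G (ξ ⊗ e^lam ⊗ 1)` (smooth normalized
induction) of `G = GL n ℝ`: smooth `f : G → ℂ` with
`f (g p) = ∏ᵢ |p_{ii}|_{ξᵢ}^{-lamᵢ-ρᵢ} f g` for all upper triangular `p ∈ G`. -/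
def principalSeries {n : ℕ} (ξ : Fin n → ZMod 2) (lam : Fin n → ℂ) :
    Submodule ℂ (GL (Fin n) ℝ → ℂ) where
  carrier := {f | IsSmooth f ∧ ∀ g p : GL (Fin n) ℝ, IsUpper p →
    f (g * p) = (∏ i, signedPow (ξ i) (-lam i - rho n i)
      ((p : Matrix (Fin n) (Fin n) ℝ) i i)) * f g}
  zero_mem' := ⟨isSmooth_zero, fun _ _ _ => by simp⟩
  add_mem' := fun {f₁ f₂} h₁ h₂ => ⟨h₁.1.add h₂.1, fun g p hp => by
    simp only [Pi.add_apply, h₁.2 g p hp, h₂.2 g p hp, mul_add]⟩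
  smul_mem' := fun c f h => ⟨h.1.const_smul c, fun g p hp => by
    simp only [Pi.smul_apply, smul_eq_mul, h.2 g p hp]; ring⟩

/-- The left regular action `(a · f) g = f (a⁻¹ g)` on the principal series. -/
def leftRegular {n : ℕ} (ξ : Fin n → ZMod 2) (lam : Fin n → ℂ) :
    Representation ℂ (GL (Fin n) ℝ) (principalSeries ξ lam) where
  toFun a :=
    { toFun := fun f => ⟨fun g => (f : GL (Fin n) ℝ → ℂ) (a⁻¹ * g),
        f.2.1.leftTranslate a⁻¹, fun g p hp => by
          change f.1 (a⁻¹ * (g * p)) = _ * f.1 (a⁻¹ * g)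
          rw [← mul_assoc]; exact f.2.2 _ p hp⟩
      map_add' := fun _ _ => rfl
      map_smul' := fun _ _ => rfl }
  map_one' := by ext f g; simp
  map_mul' a b := by ext f g; simp [mul_assoc]

/-! ### Differential symmetry breaking operators for `(GL (n+1) ℝ, GL n ℝ)` -/

/-- The embedding `h ↦ diag(h, 1)` of `H = GL n ℝ` in `G = GL (n+1) ℝ`. -/
def embedH (n : ℕ) : GL (Fin n) ℝ →* GL (Fin (n + 1)) ℝ :=
  Units.map
    { toFun := fun A => Matrix.reindex finSumFinEquiv finSumFinEquiv
        (Matrix.fromBlocks A 0 0 (1 : Matrix (Fin 1) (Fin 1) ℝ))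
      map_one' := by simp
      map_mul' := fun A B => by
        simp only [Matrix.reindex_apply]
        rw [Matrix.submatrix_mul_equiv, Matrix.fromBlocks_multiply]
        simp }

/-- The permutation matrix `x_k ∈ GL (n+1) ℝ` (`0 ≤ k ≤ n`) with rows
`e_1, …, e_k, e_{k+2}, …, e_{n+1}, e_{k+1}`, i.e. the block matrix with block rows
`(I_k, 0, 0)`, `(0, 0, I_{n-k})`, `(0, 1, 0)`. -/
def basePoint (n : ℕ) (k : Fin (n + 1)) : GL (Fin (n + 1)) ℝ where
  val := (Fin.cycleIcc k (Fin.last n)).permMatrix ℝ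
  inv := ((Fin.cycleIcc k (Fin.last n))⁻¹).permMatrix ℝ
  val_inv := by rw [← Matrix.permMatrix_mul]; simp
  inv_val := by rw [← Matrix.permMatrix_mul]; simp

/-- `DSBO_k(π_{ξ,lam}, τ_{η,ν})`: the linear maps `T : π_{ξ,lam} → τ_{η,ν}` that intertwine the
actions of `H` and are `p_k`-differential, i.e. `p_k (supp (T f)) ⊆ supp f` for the map
`p_k : H/P_H → G/P_G`, `h P_H ↦ h x_k P_G`. Sections over `G/P_G` and `H/P_H` being equivariant
functions on `G` and `H`, the support of such a function is the full preimage of the support of the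
section, and the inclusion of supports is written upstairs. -/
def DSBO {n : ℕ} (k : Fin (n + 1)) (ξ : Fin (n + 1) → ZMod 2) (lam : Fin (n + 1) → ℂ)
    (η : Fin n → ZMod 2) (ν : Fin n → ℂ) :
    Submodule ℂ (principalSeries ξ lam →ₗ[ℂ] principalSeries η ν) where
  carrier := {T |
    (∀ h : GL (Fin n) ℝ, T ∘ₗ leftRegular ξ lam (embedH n h) = leftRegular η ν h ∘ₗ T) ∧
    ∀ f : principalSeries ξ lam, ∀ h ∈ tsupport (T f : GL (Fin n) ℝ → ℂ),
      embedH n h * basePoint n k ∈ tsupport (f : GL (Fin (n + 1)) ℝ → ℂ)}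
  zero_mem' := ⟨fun h => by simp, fun f h hh => by simp [tsupport] at hh⟩
  add_mem' := fun {S T} hS hT => ⟨fun h => by
      rw [LinearMap.add_comp, LinearMap.comp_add, hS.1, hT.1],
    fun f h hh => (tsupport_add _ _ hh).elim (hS.2 f h) (hT.2 f h)⟩
  smul_mem' := fun c T hT => ⟨fun h => by
      rw [LinearMap.smul_comp, LinearMap.comp_smul, hT.1],
    fun f h hh => hT.2 f h (closure_mono (Function.support_const_smul_subset c _) hh)⟩

/-! ### Distribution kernels for `n = 2` -/

/-- The lower triangular unipotent matrix with coordinates `(x, y, z)`. -/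
def nbar (x y z : ℝ) : GL (Fin 3) ℝ :=
  Matrix.GeneralLinearGroup.mkOfDetNeZero !![1, 0, 0; x, 1, 0; z, y, 1]
    (by simp [Matrix.det_fin_three])

/-- The pairing `⟨δ^{(a)}(x) δ^{(b)}(y) δ^{(c)}(z), φ⟩ = (-1)^{a+b+c} (∂_x^a ∂_y^b ∂_z^c φ)(0)`. -/
def deltaDeriv (a b c : ℕ) (φ : ℝ → ℝ → ℝ → ℂ) : ℂ :=
  (-1) ^ (a + b + c) *
    iteratedDeriv a (fun x => iteratedDeriv b (fun y => iteratedDeriv c (fun z => φ x y z) 0) 0) 0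

/-- The operator `T : π_{ξ,lam} → τ_{η,ν}` is given by the distribution kernel `K` on
`N̄ ≅ ℝ³` based at `x_k`: `T f (h) = ⟨K, f (h x_k n̄(x, y, z))⟩` for all `f` and `h`. -/
def HasKernel (k : Fin 3) {ξ : Fin 3 → ZMod 2} {lam : Fin 3 → ℂ} {η : Fin 2 → ZMod 2}
    {ν : Fin 2 → ℂ} (T : principalSeries ξ lam →ₗ[ℂ] principalSeries η ν)
    (K : (ℝ → ℝ → ℝ → ℂ) → ℂ) : Prop :=
  ∀ (f : principalSeries ξ lam) (h : GL (Fin 2) ℝ),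
    (T f : GL (Fin 2) ℝ → ℂ) h =
      K (fun x y z => (f : GL (Fin 3) ℝ → ℂ) (embedH 2 h * basePoint 2 k * nbar x y z))

/-- The kernel `∑_{j=0}^{min(n₁,n₂)} ((-1)^j (-n₁)_j (lam₁-lam₂+n₁-n₂)_j / j!)
δ^{(n₁-j)}(x) δ^{(n₂-j)}(y) δ^{(j)}(z)`, where `(a)_j = a (a+1) ⋯ (a+j-1)`. -/
def kernelTwo (lam : Fin 3 → ℂ) (n₁ n₂ : ℕ) (φ : ℝ → ℝ → ℝ → ℂ) : ℂ :=
  ∑ j ∈ Finset.range (min n₁ n₂ + 1),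
    ((-1) ^ j * (ascPochhammer ℂ j).eval (-(n₁ : ℂ)) *
        (ascPochhammer ℂ j).eval (lam 0 - lam 1 + n₁ - n₂) / (j.factorial : ℂ)) *
      deltaDeriv (n₁ - j) (n₂ - j) j φ

/-- The integrality and parity conditions on the parameters, with
`ν₁ - lam₁ - 1/2 = n₁ ∈ ℕ` and `ν₁ + ν₂ - lam₁ - lam₂ - 1 = n₂ ∈ ℕ`. -/
def Admissible (ξ : Fin 3 → ZMod 2) (lam : Fin 3 → ℂ) (η : Fin 2 → ZMod 2) (ν : Fin 2 → ℂ)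
    (n₁ n₂ : ℕ) : Prop :=
  ν 0 - lam 0 - 1 / 2 = n₁ ∧
  ν 0 + ν 1 - lam 0 - lam 1 - 1 = n₂ ∧
  (n₁ ≤ n₂ ∨ ∃ k₀ : ℕ, k₀ ≤ n₂ ∧ lam 0 - lam 1 + n₁ - n₂ + k₀ = 0) ∧
  η 0 = ξ 0 + n₁ ∧
  η 1 = ξ 1 + (n₁ + n₂)

end GLBranching

end

open scoped ContDiff

noncomputable section

namespace GLBranching

/-! ### Gluing of smooth functions along a sequence of points -/

section Gluing
variable {E : Type*} [NormedAddCommGroup E] [NormedSpace ℝ E] [FiniteDimensional ℝ E]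

/-! An intertwining operator is determined by the functional `f ↦ T f 1`, and the support condition
makes this functional depend only on the germ of `f` at the identity, that is, on the germ at `0` of
its restriction to the lower unipotent matrices (`chart`). A Peetre argument (`DSBO.exists_order`)
shows that only finitely many derivatives enter. If not, germs flat to higher and higher order, on
which the functional takes the values `k`, could be glued at points `2⁻ᵏ e` tending to `0`.
Translations in `x` come from `H`, so some `T F` would be unbounded near the identity. Hence `T f 1`
is a finite combination of jets at `0`.

What remains is equivariance under the upper triangular subgroup of `H`. The diagonal matrices allow
only the jets `(n₁ - j, n₂ - j, j)` and force the conditions on exponents and parities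
(`DSBO.coeff_ne_zero`). Write `c_j` for the coefficient of this jet and `A = λ₁ - λ₂ + n₁ - n₂`.
Differentiating along the unipotent matrices gives `(j + 1) c_{j+1} = (j - n₁) (A + j) c_j`, whose
solution is the Pochhammer formula; so `c_0` determines everything.

The recurrence must also stop. If `n₁ ≤ n₂` the factor `j - n₁` stops it. If `n₁ > n₂` it ends at `j
= n₂` with the extra condition `(A + n₂) c_{n₂} = 0`, so a nonzero solution needs `A + k₀ = 0` for
some `0 ≤ k₀ ≤ n₂` (`DSBO.le_or_exists`). Conversely, under these conditions the sum obtained by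
applying the vector field to the kernel telescopes to zero (`kernelFun_unipotentField`), and
`kernelOperator` is the required operator. -/

theorem norm_iteratedFDeriv_le_pow_of_jet_eq_zero {f : E → ℂ} (hf : ContDiff ℝ ∞ f) (n : ℕ)
    (h : ∀ p ≤ n, iteratedFDeriv ℝ p f 0 = 0) (q : ℕ) (hq : q ≤ n + 1) :
    ∃ C, 0 ≤ C ∧ ∀ u : E, ‖u‖ ≤ 1 → ‖iteratedFDeriv ℝ (n + 1 - q) f u‖ ≤ C * ‖u‖ ^ q := by
  have : ProperSpace E := FiniteDimensional.proper ℝ E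
  -- Compactness bounds the derivative of top order `n + 1`. Each mean value estimate from `0`,
  -- where the next lower derivative vanishes, then gains one factor `‖u‖`.
  induction q with
  | zero =>
    have hc : Continuous (iteratedFDeriv ℝ (n + 1) f) :=
      hf.continuous_iteratedFDeriv (by exact_mod_cast le_top)
    obtain ⟨C, hC⟩ := (isCompact_closedBall (0 : E) 1).exists_bound_of_continuousOn hc.continuousOn
    refine ⟨C, (norm_nonneg _).trans (hC 0 (by simp)), fun u hu => ?_⟩
    simpa using hC u (by simpa using hu)
  | succ q ih =>
    obtain ⟨C, hC0, hC⟩ := ih (by omega)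
    refine ⟨C, hC0, fun u hu => ?_⟩
    have e : n + 1 - q = (n + 1 - (q + 1)) + 1 := by omega
    have key := (convex_closedBall (0 : E) ‖u‖).norm_image_sub_le_of_norm_fderiv_le (𝕜 := ℝ)
      (f := iteratedFDeriv ℝ (n + 1 - (q + 1)) f) (C := C * ‖u‖ ^ q) (x := 0) (y := u)
      (fun x _ => (hf.differentiable_iteratedFDeriv (WithTop.coe_lt_coe.2 (ENat.natCast_lt_top _))) x)
      (fun x hx => by
        rw [norm_fderiv_iteratedFDeriv, ← e]
        have hx' : ‖x‖ ≤ ‖u‖ := by simpa using hx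
        exact (hC x (hx'.trans hu)).trans (by gcongr))
      (by simp) (by simp)
    rw [h _ (by omega), sub_zero, sub_zero] at key
    rw [pow_succ, ← mul_assoc]; exact key

/-- Cutting off at scale `δ` costs `δ⁻¹` for each derivative that falls on `χ`, but flatness of `f`
to order `n` more than compensates: on the support the derivatives of order at most `n` are `O(δ)`.
-/
theorem exists_norm_iteratedFDeriv_cutoff_le {χ f : E → ℂ} (hχ : ContDiff ℝ ∞ χ)
    (hsupp : ∀ u, 2 ≤ ‖u‖ → χ u = 0) (hf : ContDiff ℝ ∞ f) (n : ℕ)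
    (h : ∀ p ≤ n, iteratedFDeriv ℝ p f 0 = 0) {ε : ℝ} (hε : 0 < ε) {r : ℝ} (hr : 0 < r) :
    ∃ δ, 0 < δ ∧ δ ≤ r ∧ ∀ p ≤ n, ∀ u,
      ‖iteratedFDeriv ℝ p (fun v => χ (δ⁻¹ • v) * f v) u‖ ≤ ε := by
  have : ProperSpace E := FiniteDimensional.proper ℝ E
  have hcs : HasCompactSupport χ := HasCompactSupport.intro (isCompact_closedBall (0 : E) 2)
    fun u hu => hsupp u (by simp at hu; exact hu.le)
  have hB : ∀ i : ℕ, ∃ C, ∀ u, ‖iteratedFDeriv ℝ i χ u‖ ≤ C := fun i =>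
    HasCompactSupport.exists_bound_of_continuous (hcs.iteratedFDeriv (𝕜 := ℝ) i)
      (hχ.continuous_iteratedFDeriv (by exact_mod_cast le_top))
  choose B hB using hB
  have hB0 : ∀ i, 0 ≤ B i := fun i => (norm_nonneg _).trans (hB i 0)
  have hA : ∀ q : ℕ, ∃ C, 0 ≤ C ∧ (q ≤ n + 1 → ∀ u : E, ‖u‖ ≤ 1 →
      ‖iteratedFDeriv ℝ (n + 1 - q) f u‖ ≤ C * ‖u‖ ^ q) := fun q => by
    by_cases hq : q ≤ n + 1
    · obtain ⟨C, h0, hC⟩ := norm_iteratedFDeriv_le_pow_of_jet_eq_zero hf n h q hq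
      exact ⟨C, h0, fun _ => hC⟩
    · exact ⟨0, le_rfl, fun h => absurd h hq⟩
  choose A hA0 hA using hA
  set K : ℝ := ∑ p ∈ Finset.range (n + 1), ∑ i ∈ Finset.range (p + 1),
    (p.choose i) * B i * (A (n + 1 - (p - i)) * 2 ^ (n + 1 - (p - i))) with hK
  have hK0 : 0 ≤ K := Finset.sum_nonneg fun p _ => Finset.sum_nonneg fun i _ => by
    have := hB0 i; have := hA0 (n + 1 - (p - i)); positivity
  refine ⟨min r (min (1 / 2) (ε / (K + 1))), by positivity, min_le_left _ _, fun p hp u => ?_⟩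
  set δ := min r (min (1 / 2) (ε / (K + 1))) with hδ
  have hδ0 : 0 < δ := by positivity
  have hδ1 : δ ≤ 1 / 2 := (min_le_right _ _).trans (min_le_left _ _)
  have hδ2 : δ ≤ ε / (K + 1) := (min_le_right _ _).trans (min_le_right _ _)
  have hχ' : ContDiff ℝ ∞ (fun v : E => χ (δ⁻¹ • v)) := hχ.comp (contDiff_const_smul _)
  by_cases hu : 2 * δ < ‖u‖
  · have : (fun v => χ (δ⁻¹ • v) * f v) =ᶠ[nhds u] fun _ => 0 := by
      filter_upwards [continuous_norm.continuousAt.eventually (lt_mem_nhds hu)] with v hv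
      rw [hsupp, zero_mul]
      rw [norm_smul, norm_inv, Real.norm_of_nonneg hδ0.le, le_inv_mul_iff₀ hδ0]; linarith
    rw [(this.iteratedFDeriv ℝ p).eq_of_nhds]
    rw [iteratedFDeriv_fun_zero]
    simpa using hε.le
  push Not at hu
  have hu1 : ‖u‖ ≤ 1 := by linarith
  calc _ ≤ ∑ i ∈ Finset.range (p + 1), (p.choose i) *
        ‖iteratedFDeriv ℝ i (fun v => χ (δ⁻¹ • v)) u‖ * ‖iteratedFDeriv ℝ (p - i) f u‖ :=
        norm_iteratedFDeriv_mul_le hχ' hf u (by exact_mod_cast le_top)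
    _ ≤ ∑ i ∈ Finset.range (p + 1), (p.choose i) * B i *
          (A (n + 1 - (p - i)) * 2 ^ (n + 1 - (p - i))) * δ := by
        refine Finset.sum_le_sum fun i hi => ?_
        have hip : i ≤ p := by simpa [Nat.lt_succ_iff] using hi
        have h1 : ‖iteratedFDeriv ℝ i (fun v => χ (δ⁻¹ • v)) u‖ ≤ (δ⁻¹) ^ i * B i := by
          rw [iteratedFDeriv_comp_const_smul δ⁻¹ (hχ.of_le (by exact_mod_cast le_top)), norm_smul,
            norm_pow, norm_inv, Real.norm_of_nonneg hδ0.le]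
          gcongr; exact hB _ _
        have h2 : ‖iteratedFDeriv ℝ (p - i) f u‖ ≤
            A (n + 1 - (p - i)) * (2 * δ) ^ (n + 1 - (p - i)) := by
          have := hA (n + 1 - (p - i)) (by omega) u hu1
          rw [show n + 1 - (n + 1 - (p - i)) = p - i by omega] at this
          exact this.trans (mul_le_mul_of_nonneg_left (by gcongr) (hA0 _))
        -- The factor `δ ^ i` cancels the loss from the cutoff, one `δ` is kept for smallness, and
        -- the rest is at most `1`.
        have e : δ ^ (n + 1 - (p - i)) = δ ^ i * δ * δ ^ (n - p) := by
          rw [← pow_succ, ← pow_add]; congr 1; omega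
        have h3 : δ ^ (n - p) ≤ 1 := pow_le_one₀ hδ0.le (by linarith)
        calc _ ≤ (p.choose i) * ((δ⁻¹) ^ i * B i) *
              (A (n + 1 - (p - i)) * (2 * δ) ^ (n + 1 - (p - i))) := by
              have := hB0 i; gcongr
          _ = (p.choose i) * B i * (A (n + 1 - (p - i)) * 2 ^ (n + 1 - (p - i))) * δ *
              δ ^ (n - p) := by
              rw [mul_pow, e, inv_pow]; field_simp
          _ ≤ _ := by
              have := hB0 i; have := hA0 (n + 1 - (p - i))
              exact mul_le_of_le_one_right (by positivity) h3
    _ ≤ K * δ := by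
        rw [← Finset.sum_mul]
        refine mul_le_mul_of_nonneg_right ?_ hδ0.le
        exact Finset.single_le_sum (f := fun p => ∑ i ∈ Finset.range (p + 1),
          (p.choose i) * B i * (A (n + 1 - (p - i)) * 2 ^ (n + 1 - (p - i))))
          (fun p _ => Finset.sum_nonneg fun i _ => by
            have := hB0 i; have := hA0 (n + 1 - (p - i)); positivity) (by simp; omega)
    _ ≤ K * (ε / (K + 1)) := by gcongr
    _ ≤ ε := by
        rw [mul_div_assoc', div_le_iff₀ (by positivity)]; nlinarith

theorem exists_smooth_cutoff : ∃ χ : E → ℂ, ContDiff ℝ ∞ χ ∧ (∀ u, ‖u‖ ≤ 1 → χ u = 1) ∧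
    ∀ u, 2 ≤ ‖u‖ → χ u = 0 := by
  let B : ContDiffBump (0 : E) := ⟨1, 2, by norm_num, by norm_num⟩
  refine ⟨fun u => ((B u : ℝ) : ℂ), Complex.ofRealCLM.contDiff.comp B.contDiff, fun u hu => ?_,
    fun u hu => ?_⟩
  · dsimp only
    rw [B.one_of_mem_closedBall (by simpa [B] using hu)]; simp
  · dsimp only
    rw [B.zero_of_le_dist (by simpa [B] using hu)]; simp

theorem abs_sub_inv_two_pow_ge {j k : ℕ} (h : j ≠ k) :
    (1 / 2 : ℝ) ^ j / 2 ≤ |(1 / 2 : ℝ) ^ k - (1 / 2) ^ j| := by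
  rcases lt_or_gt_of_ne h with h | h
  · have : (1 / 2 : ℝ) ^ k ≤ (1 / 2) ^ (j + 1) :=
      pow_le_pow_of_le_one (by norm_num) (by norm_num) h
    rw [pow_succ] at this
    rw [abs_sub_comm]; exact le_trans (by linarith) (le_abs_self _)
  · have : (1 / 2 : ℝ) ^ j ≤ (1 / 2) ^ (k + 1) :=
      pow_le_pow_of_le_one (by norm_num) (by norm_num) h
    rw [pow_succ] at this
    have h0 : (0 : ℝ) < (1 / 2) ^ j := by positivity
    exact le_trans (by linarith) (le_abs_self _)

/-- Smooth germs vanishing to higher and higher order can be realized by one smooth function with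
compact support along the points `2⁻ᵏ e`. -/
theorem exists_smooth_gluing (e : E) (he : ‖e‖ = 1) (φ : ℕ → E → ℂ)
    (hφ : ∀ k, ContDiff ℝ ∞ (φ k)) (h : ∀ k, ∀ p ≤ k, iteratedFDeriv ℝ p (φ k) 0 = 0) :
    ∃ Φ : E → ℂ, ContDiff ℝ ∞ Φ ∧ HasCompactSupport Φ ∧
      ∀ k, (fun u => Φ (u + ((1 / 2 : ℝ) ^ k) • e)) =ᶠ[nhds 0] φ k := by
  have : ProperSpace E := FiniteDimensional.proper ℝ E
  obtain ⟨χ, hχ, hχ1, hχ0⟩ := exists_smooth_cutoff (E := E)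
  -- The bounds `2⁻ᵏ` are summable. The radius `2⁻ᵏ / 16` keeps each bump away from a neighbourhood
  -- of every other centre, since the distance from `2⁻ᵏ e` to the other centres is at least `2⁻ᵏ /
  -- 2`.
  have hδ := fun k : ℕ => exists_norm_iteratedFDeriv_cutoff_le hχ hχ0 (hφ k) k (h k)
    (ε := (1 / 2 : ℝ) ^ k) (by positivity) (r := (1 / 2 : ℝ) ^ k / 16) (by positivity)
  choose δ hδ0 hδr hδ using hδ
  set x : ℕ → E := fun k => ((1 / 2 : ℝ) ^ k) • e with hx
  set b : ℕ → E → ℂ := fun k v => χ ((δ k)⁻¹ • v) * φ k v with hb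
  have hbs : ∀ k v, 2 * δ k ≤ ‖v‖ → b k v = 0 := fun k v hv => by
    simp only [hb]
    rw [hχ0, zero_mul]
    rw [norm_smul, norm_inv, Real.norm_of_nonneg (hδ0 k).le, le_inv_mul_iff₀ (hδ0 k)]; linarith
  have hbc : ∀ k, ContDiff ℝ ∞ (b k) := fun k => (hχ.comp (contDiff_const_smul _)).mul (hφ k)
  refine ⟨fun u => ∑' k, b k (u - x k), ?_, ?_, fun k => ?_⟩
  · refine contDiff_tsum_of_eventually (f := fun k u => b k (u - x k))
      (v := fun _ k => (1 / 2 : ℝ) ^ k) (N := ⊤)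
      (fun k => (hbc k).comp (contDiff_id.sub contDiff_const))
      (fun _ _ => summable_geometric_two) (fun p _ => ?_)
    rw [Nat.cofinite_eq_atTop]
    -- The `k`-th bump is controlled only up to order `k`, so at order `p` the first `p` terms are
    -- left out.
    filter_upwards [Filter.eventually_ge_atTop p] with k hk u
    rw [iteratedFDeriv_comp_sub]
    exact hδ k p hk _
  · refine HasCompactSupport.intro (isCompact_closedBall (0 : E) 2) fun u hu => ?_
    have hu : 2 < ‖u‖ := by simpa using hu
    convert tsum_zero with k
    apply hbs
    have h1 : ‖x k‖ ≤ 1 := by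
      simp only [hx, norm_smul, he, mul_one, norm_pow]
      exact pow_le_one₀ (norm_nonneg _) (by norm_num)
    have h2 := norm_sub_norm_le u (x k)
    have h3 : (1 / 2 : ℝ) ^ k ≤ 1 := pow_le_one₀ (by norm_num) (by norm_num)
    have := hδr k
    linarith
  · filter_upwards [Metric.ball_mem_nhds (0 : E) (hδ0 k)] with u hu
    have hu : ‖u‖ < δ k := by simpa using hu
    rw [tsum_eq_single k]
    · change b k (u + x k - x k) = _
      rw [add_sub_cancel_right]
      simp only [hb]
      rw [hχ1, one_mul]
      rw [norm_smul, norm_inv, Real.norm_of_nonneg (hδ0 k).le, inv_mul_le_iff₀ (hδ0 k)]; linarith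
    · intro j hj
      change b j (u + x k - x j) = 0
      apply hbs
      have h1 : ‖x k - x j‖ = |(1 / 2 : ℝ) ^ k - (1 / 2) ^ j| := by
        simp only [hx, ← sub_smul, norm_smul, he, mul_one, Real.norm_eq_abs]
      have h2 := abs_sub_inv_two_pow_ge hj
      have h3 := abs_sub_inv_two_pow_ge hj.symm
      rw [abs_sub_comm] at h3
      have h4 := hδr k
      have h5 := hδr j
      have h6 : ‖x k - x j‖ - ‖u‖ ≤ ‖u + x k - x j‖ := by
        have := norm_sub_norm_le (x k - x j) (-u)
        rw [norm_neg] at this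
        rwa [show u + x k - x j = x k - x j - -u by abel]
      have h7 : (0 : ℝ) < (1 / 2) ^ j := by positivity
      linarith

end Gluing

/-! ### The functions `|x|_ε^s` -/

theorem signedPow_mul (ε : ZMod 2) (s : ℂ) (x y : ℝ) :
    signedPow ε s (x * y) = signedPow ε s x * signedPow ε s y := by
  unfold signedPow
  rw [sign_mul, abs_mul, Complex.ofReal_mul, Complex.mul_cpow_ofReal_nonneg (abs_nonneg _)
    (abs_nonneg _)]
  push_cast
  rw [mul_pow]; ring

theorem signedPow_one (ε : ZMod 2) (s : ℂ) : signedPow ε s 1 = 1 := by simp [signedPow]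

theorem signedPow_of_pos (ε : ZMod 2) (s : ℂ) {x : ℝ} (hx : 0 < x) :
    signedPow ε s x = ((x : ℝ) : ℂ) ^ s := by
  simp [signedPow, sign_pos hx, abs_of_pos hx]

theorem signedPow_neg_one (ε : ZMod 2) (s : ℂ) : signedPow ε s (-1) = (-1) ^ ε.val := by
  simp [signedPow]

/-- Away from `0` the sign is locally constant and the other factor is `exp (s log |x|)`. -/
theorem contDiffAt_signedPow (ε : ZMod 2) (s : ℂ) {x : ℝ} (hx : x ≠ 0) :
    ContDiffAt ℝ ∞ (signedPow ε s) x := by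
  have h1 : ContDiffAt ℝ ∞ (fun y : ℝ =>
      (((SignType.sign x : ℝ) : ℂ)) ^ ε.val * Complex.exp (((Real.log y : ℝ) : ℂ) * s)) x := by
    refine contDiffAt_const.mul (ContDiffAt.cexp (ContDiffAt.mul ?_ contDiffAt_const))
    exact (Complex.ofRealCLM.contDiff.contDiffAt).comp x (Real.contDiffAt_log.2 hx)
  refine h1.congr_of_eventuallyEq ?_
  have h2 : ∀ᶠ y in nhds x, SignType.sign y = SignType.sign x := by
    rcases lt_or_gt_of_ne hx with h | h
    · filter_upwards [gt_mem_nhds h] with y hy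
      rw [sign_neg h, sign_neg hy]
    · filter_upwards [lt_mem_nhds h] with y hy
      rw [sign_pos h, sign_pos hy]
  filter_upwards [h2, isOpen_ne.mem_nhds hx] with y hy hy0
  have : ((|y| : ℝ) : ℂ) ≠ 0 := by simpa using hy0
  rw [signedPow, hy, Complex.cpow_def_of_ne_zero this, ← Complex.ofReal_log (abs_nonneg _),
    Real.log_abs]

/-! ### Matrices -/

theorem coe_nbar (x y z : ℝ) :
    (nbar x y z : Matrix (Fin 3) (Fin 3) ℝ) = !![1, 0, 0; x, 1, 0; z, y, 1] := rfl

/-- The embedding `A ↦ diag(A, 1)` of matrices. -/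
def embedMatrix (A : Matrix (Fin 2) (Fin 2) ℝ) : Matrix (Fin 3) (Fin 3) ℝ :=
  !![A 0 0, A 0 1, 0; A 1 0, A 1 1, 0; 0, 0, 1]

theorem coe_embedH (h : GL (Fin 2) ℝ) :
    (embedH 2 h : Matrix (Fin 3) (Fin 3) ℝ) = embedMatrix h := by
  have e : (embedH 2 h : Matrix (Fin 3) (Fin 3) ℝ) =
    Matrix.reindex finSumFinEquiv finSumFinEquiv
        (Matrix.fromBlocks (h : Matrix (Fin 2) (Fin 2) ℝ) 0 0 (1 : Matrix (Fin 1) (Fin 1) ℝ)) := rfl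
  rw [e]
  have h0 : (finSumFinEquiv (m := 2) (n := 1)).symm 0 = Sum.inl 0 := rfl
  have h1 : (finSumFinEquiv (m := 2) (n := 1)).symm 1 = Sum.inl 1 := rfl
  have h2 : (finSumFinEquiv (m := 2) (n := 1)).symm 2 = Sum.inr 0 := rfl
  ext i j
  fin_cases i <;> fin_cases j <;>
    simp [embedMatrix, Matrix.reindex_apply, Matrix.submatrix_apply, h0, h1, h2]

theorem basePoint_two_two : basePoint 2 2 = 1 := by
  ext i j
  simp [basePoint, Matrix.one_apply, Equiv.Perm.permMatrix, show Fin.last 2 = (2 : Fin 3) from rfl]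

theorem isUnit_matrix_iff {n : ℕ} (A : Matrix (Fin n) (Fin n) ℝ) : IsUnit A ↔ A.det ≠ 0 := by
  rw [Matrix.isUnit_iff_isUnit_det, isUnit_iff_ne_zero]

theorem det_ne_zero {n : ℕ} (g : GL (Fin n) ℝ) : (g : Matrix (Fin n) (Fin n) ℝ).det ≠ 0 :=
  (isUnit_matrix_iff _).1 g.isUnit

theorem rho_three : rho 3 0 = 1 ∧ rho 3 1 = 0 ∧ rho 3 2 = -1 := by
  refine ⟨?_, ?_, ?_⟩ <;> norm_num [rho]

theorem rho_two : rho 2 0 = 1 / 2 ∧ rho 2 1 = -(1 / 2) := by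
  refine ⟨?_, ?_⟩ <;> norm_num [rho]

section
open scoped Matrix.Norms.Elementwise

theorem contDiff_matrix_entry {n : ℕ} (i j : Fin n) :
    ContDiff ℝ ∞ (fun M : Matrix (Fin n) (Fin n) ℝ => M i j) :=
  (LinearMap.toContinuousLinearMap
    ({ toFun := fun M => M i j, map_add' := fun _ _ => rfl, map_smul' := fun _ _ => rfl } :
      Matrix (Fin n) (Fin n) ℝ →ₗ[ℝ] ℝ)).contDiff

theorem contDiff_matrix_det {n : ℕ} :
    ContDiff ℝ ∞ (fun M : Matrix (Fin n) (Fin n) ℝ => M.det) := by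
  simp only [Matrix.det_apply']
  exact ContDiff.sum fun σ _ => contDiff_const.mul
    (contDiff_prod fun i _ => contDiff_matrix_entry _ _)

theorem isOpen_isUnit_matrix {n : ℕ} : IsOpen {A : Matrix (Fin n) (Fin n) ℝ | IsUnit A} := by
  simp only [isUnit_matrix_iff]
  exact isOpen_ne.preimage (contDiff_matrix_det (n := n)).continuous

end

/-! ### Functions in the principal series supported in the open cell -/

/-- The function on `3 × 3` matrices which vanishes outside the open cell and extends
`φ` by equivariance from the lower triangular unipotent matrices. -/
def cellExtension (ξ : Fin 3 → ZMod 2) (lam : Fin 3 → ℂ) (φ : ℝ × ℝ × ℝ → ℂ)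
    (M : Matrix (Fin 3) (Fin 3) ℝ) : ℂ :=
  if M 0 0 ≠ 0 ∧ M 0 0 * M 1 1 - M 0 1 * M 1 0 ≠ 0 then
    signedPow (ξ 0) (-lam 0 - rho 3 0) (M 0 0) *
    signedPow (ξ 1) (-lam 1 - rho 3 1) ((M 0 0 * M 1 1 - M 0 1 * M 1 0) / M 0 0) *
    signedPow (ξ 2) (-lam 2 - rho 3 2) (M.det / (M 0 0 * M 1 1 - M 0 1 * M 1 0)) *
    φ (M 1 0 / M 0 0, (M 0 0 * M 2 1 - M 2 0 * M 0 1) / (M 0 0 * M 1 1 - M 0 1 * M 1 0),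
      M 2 0 / M 0 0)
  else 0

/-- In a factorization of `M` as lower unipotent times upper triangular, the pivots are quotients of
successive leading minors and the coordinates are quotients of minors of the first columns. Right
multiplication by `p` multiplies every such minor by a product of diagonal entries of `p`, so the
coordinates do not change. -/
theorem cellExtension_mul (ξ : Fin 3 → ZMod 2) (lam : Fin 3 → ℂ) (φ : ℝ × ℝ × ℝ → ℂ)
    (M p : Matrix (Fin 3) (Fin 3) ℝ) (hp : p.det ≠ 0) (hu : ∀ i j : Fin 3, j < i → p i j = 0) :
    cellExtension ξ lam φ (M * p) =
      (∏ i, signedPow (ξ i) (-lam i - rho 3 i) (p i i)) * cellExtension ξ lam φ M := by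
  have h10 := hu 1 0 (by decide)
  have h20 := hu 2 0 (by decide)
  have h21 := hu 2 1 (by decide)
  have hdp : p.det = p 0 0 * p 1 1 * p 2 2 := by
    rw [Matrix.det_fin_three, h10, h20, h21]; ring
  rw [hdp] at hp
  have hp0 : p 0 0 ≠ 0 := fun h => hp (by rw [h]; ring)
  have hp1 : p 1 1 ≠ 0 := fun h => hp (by rw [h]; ring)
  have hp2 : p 2 2 ≠ 0 := fun h => hp (by rw [h]; ring)
  have e0 : ∀ i, (M * p) i 0 = M i 0 * p 0 0 := fun i => by
    simp [Matrix.mul_apply, Fin.sum_univ_three, h10, h20]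
  have e1 : ∀ i, (M * p) i 1 = M i 0 * p 0 1 + M i 1 * p 1 1 := fun i => by
    simp [Matrix.mul_apply, Fin.sum_univ_three, h21]
  have ed : (M * p) 0 0 * (M * p) 1 1 - (M * p) 0 1 * (M * p) 1 0 =
      (M 0 0 * M 1 1 - M 0 1 * M 1 0) * (p 0 0 * p 1 1) := by
    simp only [e0, e1]; ring
  have eN : (M * p) 0 0 * (M * p) 2 1 - (M * p) 2 0 * (M * p) 0 1 =
      (M 0 0 * M 2 1 - M 2 0 * M 0 1) * (p 0 0 * p 1 1) := by
    simp only [e0, e1]; ring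
  unfold cellExtension
  rw [ed, eN, e0, e0, e0, Matrix.det_mul, hdp, Fin.prod_univ_three]
  by_cases hc : M 0 0 ≠ 0 ∧ M 0 0 * M 1 1 - M 0 1 * M 1 0 ≠ 0
  · rw [if_pos hc, if_pos ⟨mul_ne_zero hc.1 hp0, mul_ne_zero hc.2 (mul_ne_zero hp0 hp1)⟩]
    obtain ⟨ha, hd⟩ := hc
    set a := M 0 0
    set d := a * M 1 1 - M 0 1 * M 1 0
    rw [mul_div_mul_right _ _ (mul_ne_zero hp0 hp1), mul_div_mul_right _ _ hp0,
      mul_div_mul_right _ _ hp0,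
      show d * (p 0 0 * p 1 1) / (a * p 0 0) = (d / a) * p 1 1 by field_simp,
      show M.det * (p 0 0 * p 1 1 * p 2 2) / (d * (p 0 0 * p 1 1)) = (M.det / d) * p 2 2 by
        field_simp]
    simp only [signedPow_mul]
    ring
  · rw [if_neg hc, if_neg, mul_zero]
    rintro ⟨h1, h2⟩
    exact hc ⟨left_ne_zero_of_mul h1, left_ne_zero_of_mul h2⟩

theorem cellExtension_nbar (ξ : Fin 3 → ZMod 2) (lam : Fin 3 → ℂ) (φ : ℝ × ℝ × ℝ → ℂ)
    (x y z : ℝ) : cellExtension ξ lam φ (nbar x y z : Matrix (Fin 3) (Fin 3) ℝ) = φ (x, y, z) := by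
  rw [coe_nbar]
  simp [cellExtension, Matrix.det_fin_three, signedPow_one]

section
open scoped Matrix.Norms.Elementwise

/-- The only problem is the boundary of the cell, where a leading minor vanishes. There
invertibility of `M` keeps some numerator nonzero, so a coordinate becomes large and compact support
makes the extension vanish nearby. -/
theorem contDiffAt_cellExtension (ξ : Fin 3 → ZMod 2) (lam : Fin 3 → ℂ) {φ : ℝ × ℝ × ℝ → ℂ}
    (hφ : ContDiff ℝ ∞ φ) (hs : HasCompactSupport φ) (M : Matrix (Fin 3) (Fin 3) ℝ)
    (hM : M.det ≠ 0) : ContDiffAt ℝ ∞ (cellExtension ξ lam φ) M := by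
  have ce : ∀ i j : Fin 3, ContDiff ℝ ∞ (fun M : Matrix (Fin 3) (Fin 3) ℝ => M i j) :=
    contDiff_matrix_entry
  have cd : ContDiff ℝ ∞ (fun M : Matrix (Fin 3) (Fin 3) ℝ => M 0 0 * M 1 1 - M 0 1 * M 1 0) :=
    ((ce 0 0).mul (ce 1 1)).sub ((ce 0 1).mul (ce 1 0))
  have cN : ContDiff ℝ ∞ (fun M : Matrix (Fin 3) (Fin 3) ℝ => M 0 0 * M 2 1 - M 2 0 * M 0 1) :=
    ((ce 0 0).mul (ce 2 1)).sub ((ce 2 0).mul (ce 0 1))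
  obtain ⟨R, hR⟩ : ∃ R : ℝ, ∀ u, φ u ≠ 0 → ‖u‖ ≤ R := by
    obtain ⟨R, hR⟩ := hs.isBounded.exists_norm_le
    exact ⟨R, fun u hu => hR u (subset_tsupport _ hu)⟩
  have zero_of : ∀ u : ℝ × ℝ × ℝ, R < ‖u‖ → φ u = 0 := fun u hu => by
    by_contra h; exact absurd (hR u h) (not_le.2 hu)
  by_cases ha : M 0 0 = 0
  · have hne : M 1 0 ≠ 0 ∨ M 2 0 ≠ 0 := by
      by_contra! h
      exact hM (by rw [Matrix.det_fin_three, ha, h.1, h.2]; ring)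
    have key : ∀ i : Fin 3, (i = 1 ∨ i = 2) → M i 0 ≠ 0 →
        cellExtension ξ lam φ =ᶠ[nhds M] fun _ => 0 := by
      intro i hi hne
      have ho : IsOpen {N : Matrix (Fin 3) (Fin 3) ℝ | R * |N 0 0| < |N i 0|} :=
        isOpen_lt (continuous_const.mul (ce 0 0).continuous.abs) (ce i 0).continuous.abs
      filter_upwards [ho.mem_nhds (by simpa [ha] using hne)] with N hN
      unfold cellExtension
      split_ifs with hc
      · rw [zero_of, mul_zero]
        have : R < |N i 0 / N 0 0| := by
          rw [abs_div, lt_div_iff₀ (abs_pos.2 hc.1)]; exact hN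
        refine this.trans_le ?_
        rcases hi with rfl | rfl
        · exact le_max_left _ _
        · exact (le_max_right _ _).trans (le_max_right _ _)
      · rfl
    rcases hne with h | h
    · exact contDiffAt_const.congr_of_eventuallyEq (key 1 (.inl rfl) h)
    · exact contDiffAt_const.congr_of_eventuallyEq (key 2 (.inr rfl) h)
  by_cases hd : M 0 0 * M 1 1 - M 0 1 * M 1 0 = 0
  · have hN : M 0 0 * M 2 1 - M 2 0 * M 0 1 ≠ 0 := by
      intro h
      -- Eliminating with the pivot `M 0 0` writes `M 0 0 * M.det` as a combination of the two `2 ×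
      -- 2` minors in the first two columns.
      have : M 0 0 * M.det = 0 := by
        rw [Matrix.det_fin_three]
        linear_combination (M 0 0 * M 2 2 - M 0 2 * M 2 0) * hd +
          (-M 0 0 * M 1 2 + M 0 2 * M 1 0) * h
      exact (mul_ne_zero ha hM) this
    have ho : IsOpen {N : Matrix (Fin 3) (Fin 3) ℝ | R * |N 0 0 * N 1 1 - N 0 1 * N 1 0| <
        |N 0 0 * N 2 1 - N 2 0 * N 0 1|} :=
      isOpen_lt (continuous_const.mul cd.continuous.abs) cN.continuous.abs
    refine contDiffAt_const (c := (0 : ℂ)) |>.congr_of_eventuallyEq ?_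
    filter_upwards [ho.mem_nhds (by simpa [hd] using hN)] with N hN
    unfold cellExtension
    split_ifs with hc
    · rw [zero_of, mul_zero]
      have : R < |(N 0 0 * N 2 1 - N 2 0 * N 0 1) / (N 0 0 * N 1 1 - N 0 1 * N 1 0)| := by
        rw [abs_div, lt_div_iff₀ (abs_pos.2 hc.2)]; exact hN
      exact this.trans_le ((le_max_left _ _).trans (le_max_right _ _))
    · rfl
  · have ho : IsOpen {N : Matrix (Fin 3) (Fin 3) ℝ | N 0 0 ≠ 0 ∧
        N 0 0 * N 1 1 - N 0 1 * N 1 0 ≠ 0} :=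
      (isOpen_ne.preimage (ce 0 0).continuous).inter (isOpen_ne.preimage cd.continuous)
    have key : ContDiffAt ℝ ∞ (fun M : Matrix (Fin 3) (Fin 3) ℝ =>
        signedPow (ξ 0) (-lam 0 - rho 3 0) (M 0 0) *
        signedPow (ξ 1) (-lam 1 - rho 3 1) ((M 0 0 * M 1 1 - M 0 1 * M 1 0) / M 0 0) *
        signedPow (ξ 2) (-lam 2 - rho 3 2) (M.det / (M 0 0 * M 1 1 - M 0 1 * M 1 0)) *
        φ (M 1 0 / M 0 0, (M 0 0 * M 2 1 - M 2 0 * M 0 1) / (M 0 0 * M 1 1 - M 0 1 * M 1 0),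
          M 2 0 / M 0 0)) M := by
      refine ((ContDiffAt.mul ?_ ?_).mul ?_).mul ?_
      · exact (contDiffAt_signedPow _ _ ha).comp M (ce 0 0).contDiffAt
      · exact (contDiffAt_signedPow _ _ (div_ne_zero hd ha)).comp M
          (cd.contDiffAt.div (ce 0 0).contDiffAt ha)
      · exact (contDiffAt_signedPow _ _ (div_ne_zero hM hd)).comp M
          (contDiff_matrix_det.contDiffAt.div cd.contDiffAt hd)
      · exact hφ.contDiffAt.comp M (((ce 1 0).contDiffAt.div (ce 0 0).contDiffAt ha).prodMk
          ((cN.contDiffAt.div cd.contDiffAt hd).prodMk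
            ((ce 2 0).contDiffAt.div (ce 0 0).contDiffAt ha)))
    refine key.congr_of_eventuallyEq ?_
    filter_upwards [ho.mem_nhds ⟨ha, hd⟩] with N hN
    unfold cellExtension
    rw [if_pos hN]

theorem exists_principalSeries_of_hasCompactSupport (ξ : Fin 3 → ZMod 2) (lam : Fin 3 → ℂ)
    {φ : ℝ × ℝ × ℝ → ℂ} (hφ : ContDiff ℝ ∞ φ) (hs : HasCompactSupport φ) :
    ∃ f : principalSeries ξ lam, ∀ x y z,
      (f : GL (Fin 3) ℝ → ℂ) (nbar x y z) = φ (x, y, z) :=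
  ⟨⟨fun g => cellExtension ξ lam φ (g : Matrix (Fin 3) (Fin 3) ℝ),
    ⟨cellExtension ξ lam φ, fun M hM =>
      (contDiffAt_cellExtension ξ lam hφ hs M ((isUnit_matrix_iff M).1 hM)).contDiffWithinAt,
      fun _ => rfl⟩,
    fun g p hp => cellExtension_mul ξ lam φ g p (det_ne_zero p) hp⟩,
    fun x y z => cellExtension_nbar ξ lam φ x y z⟩

end

/-! ### Iterated directional derivatives -/

section DirDeriv
variable {V : Type*} [NormedAddCommGroup V] [NormedSpace ℝ V]

/-- The derivative of `F` in the direction `v`. -/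
def dirDeriv (v : V) (F : V → ℂ) : V → ℂ := fun u => fderiv ℝ F u v

theorem contDiffOn_dirDeriv (v : V) {F : V → ℂ} {O : Set V} (hO : IsOpen O)
    (hF : ContDiffOn ℝ ∞ F O) : ContDiffOn ℝ ∞ (dirDeriv v F) O :=
  (hF.fderiv_of_isOpen hO (by simp)).clm_apply contDiffOn_const

theorem contDiffOn_iterate_dirDeriv (v : V) {F : V → ℂ} {O : Set V} (hO : IsOpen O)
    (hF : ContDiffOn ℝ ∞ F O) (n : ℕ) : ContDiffOn ℝ ∞ ((dirDeriv v)^[n] F) O := by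
  induction n with
  | zero => exact hF
  | succ n ih => rw [Function.iterate_succ_apply']; exact contDiffOn_dirDeriv v hO ih

theorem dirDeriv_congr (v : V) {F G : V → ℂ} {O : Set V} (hO : IsOpen O) (h : Set.EqOn F G O) :
    Set.EqOn (dirDeriv v F) (dirDeriv v G) O := fun u hu => by
  simp only [dirDeriv]
  rw [(h.eventuallyEq_of_mem (hO.mem_nhds hu)).fderiv_eq]

theorem iterate_dirDeriv_congr (v : V) {F G : V → ℂ} {O : Set V} (hO : IsOpen O)
    (h : Set.EqOn F G O) (n : ℕ) : Set.EqOn ((dirDeriv v)^[n] F) ((dirDeriv v)^[n] G) O := by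
  induction n with
  | zero => exact h
  | succ n ih => simp only [Function.iterate_succ_apply']; exact dirDeriv_congr v hO ih

theorem dirDeriv_comm (v w : V) {F : V → ℂ} {O : Set V} (hO : IsOpen O)
    (hF : ContDiffOn ℝ ∞ F O) : Set.EqOn (dirDeriv v (dirDeriv w F)) (dirDeriv w (dirDeriv v F)) O :=
  fun u hu => by
  have hc : ContDiffAt ℝ ∞ F u := hF.contDiffAt (hO.mem_nhds hu)
  have hd : DifferentiableAt ℝ (fderiv ℝ F) u :=
    ((hF.fderiv_of_isOpen hO (m := ∞) (by simp)).contDiffAt (hO.mem_nhds hu)).differentiableAt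
      (by simp)
  have hs : IsSymmSndFDerivAt ℝ F u := hc.isSymmSndFDerivAt (by simpa using (WithTop.coe_le_coe.2 le_top : ((2 : ℕ∞) : WithTop ℕ∞) ≤ ∞))
  have key : ∀ v w : V, dirDeriv v (dirDeriv w F) u = fderiv ℝ (fderiv ℝ F) u v w := fun v w => by
    unfold dirDeriv
    rw [fderiv_clm_apply hd (differentiableAt_const w)]
    simp
  rw [key, key]
  exact hs v w

theorem dirDeriv_iterate_comm (v w : V) {F : V → ℂ} {O : Set V} (hO : IsOpen O)
    (hF : ContDiffOn ℝ ∞ F O) (n : ℕ) :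
    Set.EqOn (dirDeriv v ((dirDeriv w)^[n] F)) ((dirDeriv w)^[n] (dirDeriv v F)) O := by
  induction n with
  | zero => exact fun _ _ => rfl
  | succ n ih =>
    simp only [Function.iterate_succ_apply']
    exact (dirDeriv_comm v w hO (contDiffOn_iterate_dirDeriv w hO hF n)).trans
      (dirDeriv_congr w hO ih)

/-- The mixed derivative of order `(a, b, c)` in the directions `d₁, d₂, d₃`. -/
def mixedDeriv (d₁ d₂ d₃ : V) (a b c : ℕ) (F : V → ℂ) : V → ℂ :=
  (dirDeriv d₁)^[a] ((dirDeriv d₂)^[b] ((dirDeriv d₃)^[c] F))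

theorem contDiffOn_mixedDeriv (d₁ d₂ d₃ : V) (a b c : ℕ) {F : V → ℂ} {O : Set V} (hO : IsOpen O)
    (hF : ContDiffOn ℝ ∞ F O) : ContDiffOn ℝ ∞ (mixedDeriv d₁ d₂ d₃ a b c F) O :=
  contDiffOn_iterate_dirDeriv _ hO (contDiffOn_iterate_dirDeriv _ hO
    (contDiffOn_iterate_dirDeriv _ hO hF _) _) _

theorem dirDeriv_mixedDeriv (v d₁ d₂ d₃ : V) (a b c : ℕ) {F : V → ℂ} {O : Set V} (hO : IsOpen O)
    (hF : ContDiffOn ℝ ∞ F O) :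
    Set.EqOn (dirDeriv v (mixedDeriv d₁ d₂ d₃ a b c F)) (mixedDeriv d₁ d₂ d₃ a b c (dirDeriv v F))
      O := by
  have h3 := contDiffOn_iterate_dirDeriv d₃ hO hF c
  have h2 := contDiffOn_iterate_dirDeriv d₂ hO h3 b
  exact (dirDeriv_iterate_comm v d₁ hO h2 a).trans (iterate_dirDeriv_congr d₁ hO
    ((dirDeriv_iterate_comm v d₂ hO h3 b).trans (iterate_dirDeriv_congr d₂ hO
      (dirDeriv_iterate_comm v d₃ hO hF c) b)) a)

theorem iteratedDeriv_comp_line (p v : V) {F : V → ℂ} {O : Set V} (hO : IsOpen O)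
    (hF : ContDiffOn ℝ ∞ F O) (hp : ∀ t : ℝ, p + t • v ∈ O) (n : ℕ) (t : ℝ) :
    iteratedDeriv n (fun t : ℝ => F (p + t • v)) t = (dirDeriv v)^[n] F (p + t • v) := by
  induction n generalizing t with
  | zero => simp
  | succ n ih =>
    rw [iteratedDeriv_succ, funext ih, Function.iterate_succ_apply']
    have hd : DifferentiableAt ℝ ((dirDeriv v)^[n] F) (p + t • v) :=
      ((contDiffOn_iterate_dirDeriv v hO hF n).contDiffAt (hO.mem_nhds (hp t))).differentiableAt
        (by simp)
    have hl : HasDerivAt (fun t : ℝ => p + t • v) v t := by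
      simpa using ((hasDerivAt_id t).smul_const v).const_add p
    exact (hd.hasFDerivAt.comp_hasDerivAt t hl).deriv

/-- Replaces nested one-variable derivatives by commuting operators on an open subset of a vector
space, so that symmetry of second derivatives applies. -/
theorem deltaDeriv_eq_mixedDeriv (p d₁ d₂ d₃ : V) {F : V → ℂ} {O : Set V} (hO : IsOpen O)
    (hF : ContDiffOn ℝ ∞ F O) (hp : ∀ x y z : ℝ, p + x • d₁ + y • d₂ + z • d₃ ∈ O) (a b c : ℕ) :
    deltaDeriv a b c (fun x y z => F (p + x • d₁ + y • d₂ + z • d₃)) =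
      (-1) ^ (a + b + c) * mixedDeriv d₁ d₂ d₃ a b c F p := by
  have h3 := contDiffOn_iterate_dirDeriv d₃ hO hF c
  have h2 := contDiffOn_iterate_dirDeriv d₂ hO h3 b
  unfold deltaDeriv
  congr 1
  have e3 : ∀ x y, iteratedDeriv c (fun z : ℝ => F (p + x • d₁ + y • d₂ + z • d₃)) 0 =
      (dirDeriv d₃)^[c] F (p + x • d₁ + y • d₂) := fun x y => by
    rw [iteratedDeriv_comp_line _ _ hO hF (hp x y)]; simp
  have e2 : ∀ x : ℝ, iteratedDeriv b (fun y : ℝ => (dirDeriv d₃)^[c] F (p + x • d₁ + y • d₂)) 0 =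
      (dirDeriv d₂)^[b] ((dirDeriv d₃)^[c] F) (p + x • d₁) := fun x => by
    rw [iteratedDeriv_comp_line _ _ hO h3 (fun y => by simpa using hp x y 0)]; simp
  simp only [e3]
  simp only [e2]
  rw [iteratedDeriv_comp_line _ _ hO h2 (fun x => by simpa using hp x 0 0)]
  simp [mixedDeriv]

end DirDeriv

/-! ### Jets at the origin of smooth functions on `ℝ³` -/

/-- Smooth functions on `ℝ³`. -/
def smoothFun : Submodule ℂ (ℝ × ℝ × ℝ → ℂ) where
  carrier := {φ | ContDiff ℝ ∞ φ}
  zero_mem' := show ContDiff ℝ ∞ (fun _ => (0 : ℂ)) from contDiff_const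
  add_mem' {φ ψ} h₁ h₂ :=
    show ContDiff ℝ ∞ (φ + ψ) from
      ContDiff.add (show ContDiff ℝ ∞ φ from h₁) (show ContDiff ℝ ∞ ψ from h₂)
  smul_mem' c φ h :=
    show ContDiff ℝ ∞ (c • φ) from ContDiff.const_smul c (show ContDiff ℝ ∞ φ from h)

theorem contDiff_coe (φ : smoothFun) : ContDiff ℝ ∞ (φ : ℝ × ℝ × ℝ → ℂ) := φ.2

/-- The directional derivative as an operator on smooth functions. -/
def pderiv (v : ℝ × ℝ × ℝ) : Module.End ℂ smoothFun where
  toFun φ := ⟨dirDeriv v φ, by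
    have h : ContDiff ℝ ∞ (φ : ℝ × ℝ × ℝ → ℂ) := φ.2
    exact contDiffOn_univ.1 (contDiffOn_dirDeriv v isOpen_univ h.contDiffOn)⟩
  map_add' φ ψ := by
    have h₁ : ContDiff ℝ ∞ (φ : ℝ × ℝ × ℝ → ℂ) := φ.2
    have h₂ : ContDiff ℝ ∞ (ψ : ℝ × ℝ × ℝ → ℂ) := ψ.2
    ext u
    change fderiv ℝ ((φ : ℝ × ℝ × ℝ → ℂ) + (ψ : ℝ × ℝ × ℝ → ℂ)) u v = _
    rw [fderiv_add (h₁.differentiable (by simp) u) (h₂.differentiable (by simp) u)]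
    rfl
  map_smul' c φ := by
    have h₁ : ContDiff ℝ ∞ (φ : ℝ × ℝ × ℝ → ℂ) := φ.2
    ext u
    change fderiv ℝ (c • (φ : ℝ × ℝ × ℝ → ℂ)) u v = _
    rw [fderiv_const_smul (h₁.differentiable (by simp) u)]
    rfl

/-- Multiplication by a linear form as an operator on smooth functions. -/
def mulForm (l : ℝ × ℝ × ℝ →L[ℝ] ℝ) : Module.End ℂ smoothFun where
  toFun φ := ⟨fun u => (l u : ℂ) * (φ : ℝ × ℝ × ℝ → ℂ) u,
    (Complex.ofRealCLM.contDiff.comp l.contDiff).mul (contDiff_coe φ)⟩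
  map_add' φ ψ := by ext u; exact mul_add _ _ _
  map_smul' c φ := by ext u; exact mul_left_comm _ _ _

theorem pderiv_apply (v : ℝ × ℝ × ℝ) (φ : smoothFun) (u : ℝ × ℝ × ℝ) :
    (pderiv v φ : ℝ × ℝ × ℝ → ℂ) u = fderiv ℝ (φ : ℝ × ℝ × ℝ → ℂ) u v := rfl

theorem differentiableAt_coe (φ : smoothFun) (u : ℝ × ℝ × ℝ) :
    DifferentiableAt ℝ (φ : ℝ × ℝ × ℝ → ℂ) u :=
  (contDiff_coe φ).differentiable (by simp) u

theorem commute_pderiv (v w : ℝ × ℝ × ℝ) : Commute (pderiv v) (pderiv w) := by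
  refine LinearMap.ext fun φ => Subtype.ext (funext fun u => ?_)
  have h : ContDiff ℝ ∞ (φ : ℝ × ℝ × ℝ → ℂ) := φ.2
  exact dirDeriv_comm v w isOpen_univ h.contDiffOn (Set.mem_univ u)

theorem pderiv_mul_mulForm (v : ℝ × ℝ × ℝ) (l : ℝ × ℝ × ℝ →L[ℝ] ℝ) :
    pderiv v * mulForm l = mulForm l * pderiv v + (l v : ℂ) • 1 := by
  refine LinearMap.ext fun φ => Subtype.ext (funext fun u => ?_)
  change fderiv ℝ (fun u => (l u : ℂ) * (φ : ℝ × ℝ × ℝ → ℂ) u) u v =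
    (l u : ℂ) * fderiv ℝ (φ : ℝ × ℝ × ℝ → ℂ) u v + (l v : ℂ) * (φ : ℝ × ℝ × ℝ → ℂ) u
  have hl : HasFDerivAt (fun u => ((l u : ℝ) : ℂ)) (Complex.ofRealCLM.comp l) u :=
    (Complex.ofRealCLM.comp l).hasFDerivAt
  rw [(hl.fun_mul (differentiableAt_coe φ u).hasFDerivAt).fderiv]
  simp [mul_comm]

theorem pderiv_add_smul (x y z : ℝ) : pderiv (x, y, z) =
    (x : ℂ) • pderiv (1, 0, 0) + (y : ℂ) • pderiv (0, 1, 0) + (z : ℂ) • pderiv (0, 0, 1) := by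
  refine LinearMap.ext fun φ => Subtype.ext (funext fun u => ?_)
  have : (x, y, z) = x • ((1, 0, 0) : ℝ × ℝ × ℝ) + y • (0, 1, 0) + z • (0, 0, 1) := by simp
  change fderiv ℝ (φ : ℝ × ℝ × ℝ → ℂ) u (x, y, z) = _
  rw [this, map_add, map_add, map_smul, map_smul, map_smul]
  rfl

/-- Evaluation at the origin. -/
def evalZero : smoothFun →ₗ[ℂ] ℂ where
  toFun φ := (φ : ℝ × ℝ × ℝ → ℂ) 0
  map_add' _ _ := rfl
  map_smul' _ _ := rfl

/-- The partial derivative of order `(a, b, c)` at the origin. -/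
def jet (a b c : ℕ) : smoothFun →ₗ[ℂ] ℂ :=
  evalZero ∘ₗ (pderiv (1, 0, 0) ^ a * pderiv (0, 1, 0) ^ b * pderiv (0, 0, 1) ^ c)

theorem jet_apply (a b c : ℕ) (φ : smoothFun) : jet a b c φ =
    evalZero ((pderiv (1, 0, 0) ^ a * pderiv (0, 1, 0) ^ b * pderiv (0, 0, 1) ^ c) φ) := rfl

theorem coe_pderiv_pow (v : ℝ × ℝ × ℝ) (n : ℕ) (φ : smoothFun) :
    ((pderiv v ^ n) φ : ℝ × ℝ × ℝ → ℂ) = (dirDeriv v)^[n] φ := by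
  induction n with
  | zero => rfl
  | succ n ih =>
    rw [pow_succ', Function.iterate_succ_apply', ← ih]; rfl

theorem deltaDeriv_eq_jet (a b c : ℕ) (φ : smoothFun) :
    deltaDeriv a b c (fun x y z => (φ : ℝ × ℝ × ℝ → ℂ) (x, y, z)) =
      (-1) ^ (a + b + c) * jet a b c φ := by
  have h : ContDiff ℝ ∞ (φ : ℝ × ℝ × ℝ → ℂ) := φ.2
  have := deltaDeriv_eq_mixedDeriv (0 : ℝ × ℝ × ℝ) (1, 0, 0) (0, 1, 0) (0, 0, 1) isOpen_univ
    h.contDiffOn (fun _ _ _ => Set.mem_univ _) a b c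
  simp only [Prod.smul_mk, smul_eq_mul, mul_one, mul_zero, Prod.mk_add_mk, zero_add, add_zero]
    at this
  rw [this, jet_apply]
  congr 1
  change _ = ((pderiv (1, 0, 0) ^ a) ((pderiv (0, 1, 0) ^ b) ((pderiv (0, 0, 1) ^ c) φ)) :
    ℝ × ℝ × ℝ → ℂ) 0
  simp only [coe_pderiv_pow]
  rfl

theorem jet_pderiv_fst (a b c : ℕ) (φ : smoothFun) :
    jet a b c (pderiv (1, 0, 0) φ) = jet (a + 1) b c φ := by
  rw [jet_apply, jet_apply, ← Module.End.mul_apply, pow_succ]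
  congr 2
  simp only [mul_assoc]
  congr 1
  have h1 := (commute_pderiv (1, 0, 0) (0, 1, 0)).pow_right b
  have h2 := (commute_pderiv (1, 0, 0) (0, 0, 1)).pow_right c
  rw [← h2.eq, ← mul_assoc, ← h1.eq, mul_assoc]

theorem jet_pderiv_snd (a b c : ℕ) (φ : smoothFun) :
    jet a b c (pderiv (0, 1, 0) φ) = jet a (b + 1) c φ := by
  rw [jet_apply, jet_apply, ← Module.End.mul_apply, pow_succ]
  congr 2
  simp only [mul_assoc]
  have h2 := (commute_pderiv (0, 1, 0) (0, 0, 1)).pow_right c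
  rw [← h2.eq]

theorem jet_pderiv_trd (a b c : ℕ) (φ : smoothFun) :
    jet a b c (pderiv (0, 0, 1) φ) = jet a b (c + 1) φ := by
  rw [jet_apply, jet_apply, ← Module.End.mul_apply, pow_succ]
  congr 2

/-! ### Weyl algebra relations and the action of coordinates on jets -/

theorem pow_mul_eq_of_commutator {R : Type*} [Ring R] [Algebra ℂ R] {D X : R}
    (h : D * X = X * D + 1) (n : ℕ) : D ^ n * X = X * D ^ n + (n : ℂ) • D ^ (n - 1) := by
  induction n with
  | zero => simp
  | succ n ih =>
    -- For `n = 0` the truncated exponent `n - 1` is harmless because the coefficient is zero.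
    have e : (n : ℂ) • (D * D ^ (n - 1)) = (n : ℂ) • D ^ n := by
      rcases n with _ | n
      · simp
      · rw [← pow_succ']; simp
    rw [pow_succ', mul_assoc, ih, mul_add, ← mul_assoc, h, mul_smul_comm, e]
    push_cast
    rw [add_mul, add_smul, one_mul, one_smul, mul_assoc, ← pow_succ', add_assoc,
      add_comm (D ^ n)]

/-- The coordinate `x` on `ℝ³`. -/
def coordX : ℝ × ℝ × ℝ →L[ℝ] ℝ := ContinuousLinearMap.fst ℝ ℝ (ℝ × ℝ)
/-- The coordinate `y` on `ℝ³`. -/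
def coordY : ℝ × ℝ × ℝ →L[ℝ] ℝ :=
  (ContinuousLinearMap.fst ℝ ℝ ℝ).comp (ContinuousLinearMap.snd ℝ ℝ (ℝ × ℝ))
/-- The coordinate `z` on `ℝ³`. -/
def coordZ : ℝ × ℝ × ℝ →L[ℝ] ℝ :=
  (ContinuousLinearMap.snd ℝ ℝ ℝ).comp (ContinuousLinearMap.snd ℝ ℝ (ℝ × ℝ))

theorem evalZero_mulForm (l : ℝ × ℝ × ℝ →L[ℝ] ℝ) (φ : smoothFun) : evalZero (mulForm l φ) = 0 := by
  change ((l 0 : ℝ) : ℂ) * _ = 0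
  simp

theorem commute_pderiv_mulForm {v : ℝ × ℝ × ℝ} {l : ℝ × ℝ × ℝ →L[ℝ] ℝ} (h : l v = 0) :
    Commute (pderiv v) (mulForm l) := by
  change _ = _
  rw [pderiv_mul_mulForm, h]; simp

theorem pderiv_pow_mul_mulForm {v : ℝ × ℝ × ℝ} {l : ℝ × ℝ × ℝ →L[ℝ] ℝ} (h : l v = 1) (n : ℕ) :
    pderiv v ^ n * mulForm l = mulForm l * pderiv v ^ n + (n : ℂ) • pderiv v ^ (n - 1) :=
  pow_mul_eq_of_commutator (D := pderiv v) (X := mulForm l)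
    (by rw [pderiv_mul_mulForm, h]; simp) n

theorem jet_coordX (a b c : ℕ) (φ : smoothFun) :
    jet a b c (mulForm coordX φ) = a * jet (a - 1) b c φ := by
  have h2 : Commute (pderiv (0, 1, 0) ^ b) (mulForm coordX) :=
    (commute_pderiv_mulForm (by simp [coordX])).pow_left b
  have h3 : Commute (pderiv (0, 0, 1) ^ c) (mulForm coordX) :=
    (commute_pderiv_mulForm (by simp [coordX])).pow_left c
  have h1 := pderiv_pow_mul_mulForm (v := (1, 0, 0)) (l := coordX) (by simp [coordX]) a
  have e : pderiv (1, 0, 0) ^ a * pderiv (0, 1, 0) ^ b * pderiv (0, 0, 1) ^ c * mulForm coordX =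
      mulForm coordX * (pderiv (1, 0, 0) ^ a * pderiv (0, 1, 0) ^ b * pderiv (0, 0, 1) ^ c) +
      (a : ℂ) • (pderiv (1, 0, 0) ^ (a - 1) * pderiv (0, 1, 0) ^ b * pderiv (0, 0, 1) ^ c) := by
    rw [mul_assoc, h3.eq, ← mul_assoc, mul_assoc _ _ (mulForm coordX), h2.eq, ← mul_assoc, h1]
    simp only [add_mul, smul_mul_assoc, mul_assoc]
  rw [jet_apply, jet_apply, ← Module.End.mul_apply, e, LinearMap.add_apply, map_add,
    Module.End.mul_apply, evalZero_mulForm, zero_add, LinearMap.smul_apply, map_smul, smul_eq_mul]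

theorem jet_coordY (a b c : ℕ) (φ : smoothFun) :
    jet a b c (mulForm coordY φ) = b * jet a (b - 1) c φ := by
  have h1 : Commute (pderiv (1, 0, 0) ^ a) (mulForm coordY) :=
    (commute_pderiv_mulForm (by simp [coordY])).pow_left a
  have h3 : Commute (pderiv (0, 0, 1) ^ c) (mulForm coordY) :=
    (commute_pderiv_mulForm (by simp [coordY])).pow_left c
  have h2 := pderiv_pow_mul_mulForm (v := (0, 1, 0)) (l := coordY) (by simp [coordY]) b
  have e : pderiv (1, 0, 0) ^ a * pderiv (0, 1, 0) ^ b * pderiv (0, 0, 1) ^ c * mulForm coordY =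
      mulForm coordY * (pderiv (1, 0, 0) ^ a * pderiv (0, 1, 0) ^ b * pderiv (0, 0, 1) ^ c) +
      (b : ℂ) • (pderiv (1, 0, 0) ^ a * pderiv (0, 1, 0) ^ (b - 1) * pderiv (0, 0, 1) ^ c) := by
    rw [mul_assoc, h3.eq, ← mul_assoc, mul_assoc _ _ (mulForm coordY), h2, mul_add, ← mul_assoc,
      h1.eq]
    simp only [add_mul, smul_mul_assoc, mul_smul_comm, mul_assoc]
  rw [jet_apply, jet_apply, ← Module.End.mul_apply, e, LinearMap.add_apply, map_add,
    Module.End.mul_apply, evalZero_mulForm, zero_add, LinearMap.smul_apply, map_smul, smul_eq_mul]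

theorem jet_coordZ (a b c : ℕ) (φ : smoothFun) :
    jet a b c (mulForm coordZ φ) = c * jet a b (c - 1) φ := by
  have h1 : Commute (pderiv (1, 0, 0) ^ a) (mulForm coordZ) :=
    (commute_pderiv_mulForm (by simp [coordZ])).pow_left a
  have h2 : Commute (pderiv (0, 1, 0) ^ b) (mulForm coordZ) :=
    (commute_pderiv_mulForm (by simp [coordZ])).pow_left b
  have h3 := pderiv_pow_mul_mulForm (v := (0, 0, 1)) (l := coordZ) (by simp [coordZ]) c
  have e : pderiv (1, 0, 0) ^ a * pderiv (0, 1, 0) ^ b * pderiv (0, 0, 1) ^ c * mulForm coordZ =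
      mulForm coordZ * (pderiv (1, 0, 0) ^ a * pderiv (0, 1, 0) ^ b * pderiv (0, 0, 1) ^ c) +
      (c : ℂ) • (pderiv (1, 0, 0) ^ a * pderiv (0, 1, 0) ^ b * pderiv (0, 0, 1) ^ (c - 1)) := by
    rw [mul_assoc, h3, mul_add, ← mul_assoc, (h1.mul_left h2).eq]
    simp only [mul_smul_comm, mul_assoc]
  rw [jet_apply, jet_apply, ← Module.End.mul_apply, e, LinearMap.add_apply, map_add,
    Module.End.mul_apply, evalZero_mulForm, zero_add, LinearMap.smul_apply, map_smul, smul_eq_mul]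

/-- By induction on the order: peel off the last direction, expand it in the standard basis, and use
that a partial derivative shifts the index of a jet. -/
theorem iteratedFDeriv_eq_zero_of_jet_eq_zero (p : ℕ) (φ : smoothFun)
    (h : ∀ a b c, a + b + c = p → jet a b c φ = 0) :
    iteratedFDeriv ℝ p (φ : ℝ × ℝ × ℝ → ℂ) 0 = 0 := by
  induction p generalizing φ with
  | zero =>
    ext m
    simpa [jet, evalZero] using h 0 0 0 rfl
  | succ p ih =>
    ext m
    have hφ : ContDiff ℝ ∞ (φ : ℝ × ℝ × ℝ → ℂ) := φ.2
    have hf : ContDiff ℝ ∞ (fderiv ℝ (φ : ℝ × ℝ × ℝ → ℂ)) := hφ.fderiv_right (by simp)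
    set v := m (Fin.last p)
    have e := (ContinuousLinearMap.apply ℝ ℂ v).iteratedFDeriv_comp_left (hf.contDiffAt (x := 0))
      (i := p) (by exact_mod_cast le_top)
    have e' : (ContinuousLinearMap.apply ℝ ℂ v) ∘ (fderiv ℝ (φ : ℝ × ℝ × ℝ → ℂ)) =
        (pderiv v φ : ℝ × ℝ × ℝ → ℂ) := rfl
    rw [e', ih] at e
    · rw [iteratedFDeriv_succ_apply_right]
      exact (congrArg (fun T => T (Fin.init m)) e).symm
    · intro a b c habc
      obtain ⟨x, y, z⟩ := v
      rw [pderiv_add_smul]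
      simp only [LinearMap.add_apply, LinearMap.smul_apply, map_add, map_smul, jet_pderiv_fst,
        jet_pderiv_snd, jet_pderiv_trd]
      rw [h (a + 1) b c (by omega), h a (b + 1) c (by omega), h a b (c + 1) (by omega)]
      simp

theorem pderiv_pow_eventuallyEq_zero (v : ℝ × ℝ × ℝ) (n : ℕ) {φ : smoothFun}
    (h : (φ : ℝ × ℝ × ℝ → ℂ) =ᶠ[nhds 0] 0) :
    ((pderiv v ^ n) φ : ℝ × ℝ × ℝ → ℂ) =ᶠ[nhds 0] 0 := by
  rw [coe_pderiv_pow]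
  induction n with
  | zero => exact h
  | succ n ih =>
    rw [Function.iterate_succ_apply']
    filter_upwards [ih.fderiv (𝕜 := ℝ)] with u hu
    simp only [dirDeriv]
    rw [hu]; simp

theorem jet_eq_zero_of_eventuallyEq (a b c : ℕ) {φ : smoothFun}
    (h : (φ : ℝ × ℝ × ℝ → ℂ) =ᶠ[nhds 0] 0) : jet a b c φ = 0 :=
  (pderiv_pow_eventuallyEq_zero _ a (pderiv_pow_eventuallyEq_zero _ b
    (pderiv_pow_eventuallyEq_zero _ c h))).eq_of_nhds

theorem jet_coordX_pow (a b c i : ℕ) (φ : smoothFun) :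
    jet a b c ((mulForm coordX ^ i) φ) = a.descFactorial i * jet (a - i) b c φ := by
  induction i generalizing φ with
  | zero => simp
  | succ i ih =>
    rw [pow_succ, Module.End.mul_apply, ih, jet_coordX, Nat.descFactorial_succ, Nat.sub_sub]
    push_cast; ring

theorem jet_coordY_pow (a b c i : ℕ) (φ : smoothFun) :
    jet a b c ((mulForm coordY ^ i) φ) = b.descFactorial i * jet a (b - i) c φ := by
  induction i generalizing φ with
  | zero => simp
  | succ i ih =>
    rw [pow_succ, Module.End.mul_apply, ih, jet_coordY, Nat.descFactorial_succ, Nat.sub_sub]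
    push_cast; ring

theorem jet_coordZ_pow (a b c i : ℕ) (φ : smoothFun) :
    jet a b c ((mulForm coordZ ^ i) φ) = c.descFactorial i * jet a b (c - i) φ := by
  induction i generalizing φ with
  | zero => simp
  | succ i ih =>
    rw [pow_succ, Module.End.mul_apply, ih, jet_coordZ, Nat.descFactorial_succ, Nat.sub_sub]
    push_cast; ring

/-- The constant function `1`. -/
def oneFun : smoothFun := ⟨fun _ => 1, show ContDiff ℝ ∞ (fun _ => (1 : ℂ)) from contDiff_const⟩

theorem pderiv_oneFun (v : ℝ × ℝ × ℝ) : pderiv v oneFun = 0 := by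
  ext u
  change fderiv ℝ (fun _ => (1 : ℂ)) u v = 0
  simp

theorem jet_oneFun (a b c : ℕ) : jet a b c oneFun = if a = 0 ∧ b = 0 ∧ c = 0 then 1 else 0 := by
  rcases a with _ | a
  · rcases b with _ | b
    · rcases c with _ | c
      · simp [jet, evalZero, oneFun]
      · rw [← jet_pderiv_trd, pderiv_oneFun]; simp
    · rw [← jet_pderiv_snd, pderiv_oneFun]; simp
  · rw [← jet_pderiv_fst, pderiv_oneFun]; simp

/-- Smooth functions with compact support dual to the derivatives at the origin. -/
theorem exists_dual_jet (i j k : ℕ) : ∃ φ : smoothFun, HasCompactSupport (φ : ℝ × ℝ × ℝ → ℂ) ∧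
    ∀ a b c, jet a b c φ = if (a, b, c) = (i, j, k) then 1 else 0 := by
  obtain ⟨χ, hχ, hχ1, hχ0⟩ := exists_smooth_cutoff (E := ℝ × ℝ × ℝ)
  set C : ℂ := ((i.factorial * j.factorial * k.factorial : ℕ) : ℂ)⁻¹ with hC
  -- The monomial `xⁱ yʲ zᵏ / (i! j! k!)`; multiplying it by a cutoff equal to `1` near `0` does not
  -- change its jets.
  set ψ : smoothFun := C •
    ((mulForm coordX ^ i) ((mulForm coordY ^ j) ((mulForm coordZ ^ k) oneFun))) with hψ
  have hψc : ContDiff ℝ ∞ (ψ : ℝ × ℝ × ℝ → ℂ) := ψ.2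
  have hjet : ∀ a b c, jet a b c ψ = if (a, b, c) = (i, j, k) then 1 else 0 := fun a b c => by
    rw [hψ, map_smul, jet_coordX_pow, jet_coordY_pow, jet_coordZ_pow, jet_oneFun]
    by_cases h : (a, b, c) = (i, j, k)
    · simp only [Prod.mk.injEq] at h
      obtain ⟨rfl, rfl, rfl⟩ := h
      have h0 : ((a.factorial * b.factorial * c.factorial : ℕ) : ℂ) ≠ 0 := by
        exact_mod_cast (by positivity : a.factorial * b.factorial * c.factorial ≠ 0)
      simp only [Nat.descFactorial_self, Nat.sub_self, and_self, if_true, hC, smul_eq_mul]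
      rw [mul_one, inv_mul_eq_one₀ h0]
      push_cast; ring
    · rw [if_neg h]
      by_cases h' : a - i = 0 ∧ b - j = 0 ∧ c - k = 0
      · have : a < i ∨ b < j ∨ c < k := by
          by_contra! h2
          exact h (by simp only [Prod.mk.injEq]; omega)
        rcases this with h2 | h2 | h2 <;> simp [Nat.descFactorial_eq_zero_iff_lt.2 h2]
      · rw [if_neg h']; simp
  refine ⟨⟨fun u => χ u * (ψ : ℝ × ℝ × ℝ → ℂ) u, hχ.mul hψc⟩, ?_, fun a b c => ?_⟩
  · refine HasCompactSupport.intro (isCompact_closedBall (0 : ℝ × ℝ × ℝ) 2) fun u hu => ?_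
    change χ u * _ = 0
    rw [hχ0, zero_mul]
    simp at hu
    simpa using hu.le
  · rw [← hjet a b c, ← sub_eq_zero, ← map_sub]
    refine jet_eq_zero_of_eventuallyEq a b c ?_
    filter_upwards [Metric.ball_mem_nhds (0 : ℝ × ℝ × ℝ) one_pos] with u hu
    change χ u * (ψ : ℝ × ℝ × ℝ → ℂ) u - (ψ : ℝ × ℝ × ℝ → ℂ) u = 0
    rw [hχ1 u (by simpa using (mem_ball_zero_iff.1 hu).le)]; ring

/-! ### The principal series in the coordinates of the open cell -/

section Scale

/-- Composition with a diagonal linear map as an operator on smooth functions. -/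
def scaleFun (α β γ : ℝ) : Module.End ℂ smoothFun where
  toFun φ := ⟨fun u => (φ : ℝ × ℝ × ℝ → ℂ) (α * u.1, β * u.2.1, γ * u.2.2),
    (contDiff_coe φ).comp (f := fun u : ℝ × ℝ × ℝ => (α * u.1, β * u.2.1, γ * u.2.2))
      (by fun_prop)⟩
  map_add' _ _ := rfl
  map_smul' _ _ := rfl

theorem fderiv_scaleFun (α β γ : ℝ) (φ : smoothFun) (u v : ℝ × ℝ × ℝ) :
    fderiv ℝ (scaleFun α β γ φ : ℝ × ℝ × ℝ → ℂ) u v =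
      fderiv ℝ (φ : ℝ × ℝ × ℝ → ℂ) (α * u.1, β * u.2.1, γ * u.2.2)
        (α * v.1, β * v.2.1, γ * v.2.2) := by
  let L : ℝ × ℝ × ℝ →L[ℝ] ℝ × ℝ × ℝ :=
    (α • coordX).prod ((β • coordY).prod (γ • coordZ))
  have h := ((differentiableAt_coe φ (L u)).hasFDerivAt.comp u L.hasFDerivAt).fderiv
  exact congrArg (fun T => T v) h

theorem pderiv_scaleFun_fst (α β γ : ℝ) (n : ℕ) (φ : smoothFun) :
    (pderiv (1, 0, 0) ^ n) (scaleFun α β γ φ) =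
      (α : ℂ) ^ n • scaleFun α β γ ((pderiv (1, 0, 0) ^ n) φ) := by
  induction n with
  | zero => simp
  | succ n ih =>
    rw [pow_succ', Module.End.mul_apply, ih, map_smul, pow_succ, mul_smul, Module.End.mul_apply]
    congr 1
    ext u
    rw [pderiv_apply, fderiv_scaleFun]
    have : ((α * 1, β * 0, γ * 0) : ℝ × ℝ × ℝ) = α • (1, 0, 0) := by simp
    rw [this, map_smul]; rfl

theorem pderiv_scaleFun_snd (α β γ : ℝ) (n : ℕ) (φ : smoothFun) :
    (pderiv (0, 1, 0) ^ n) (scaleFun α β γ φ) =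
      (β : ℂ) ^ n • scaleFun α β γ ((pderiv (0, 1, 0) ^ n) φ) := by
  induction n with
  | zero => simp
  | succ n ih =>
    rw [pow_succ', Module.End.mul_apply, ih, map_smul, pow_succ, mul_smul, Module.End.mul_apply]
    congr 1
    ext u
    rw [pderiv_apply, fderiv_scaleFun]
    have : ((α * 0, β * 1, γ * 0) : ℝ × ℝ × ℝ) = β • (0, 1, 0) := by simp
    rw [this, map_smul]; rfl

theorem pderiv_scaleFun_trd (α β γ : ℝ) (n : ℕ) (φ : smoothFun) :
    (pderiv (0, 0, 1) ^ n) (scaleFun α β γ φ) =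
      (γ : ℂ) ^ n • scaleFun α β γ ((pderiv (0, 0, 1) ^ n) φ) := by
  induction n with
  | zero => simp
  | succ n ih =>
    rw [pow_succ', Module.End.mul_apply, ih, map_smul, pow_succ, mul_smul, Module.End.mul_apply]
    congr 1
    ext u
    rw [pderiv_apply, fderiv_scaleFun]
    have : ((α * 0, β * 0, γ * 1) : ℝ × ℝ × ℝ) = γ • (0, 0, 1) := by simp
    rw [this, map_smul]; rfl

theorem jet_scaleFun (α β γ : ℝ) (a b c : ℕ) (φ : smoothFun) :
    jet a b c (scaleFun α β γ φ) = (α : ℂ) ^ a * (β : ℂ) ^ b * (γ : ℂ) ^ c * jet a b c φ := by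
  have e : ∀ ψ : smoothFun, evalZero (scaleFun α β γ ψ) = evalZero ψ := fun ψ => by
    simp [evalZero, scaleFun]; rfl
  rw [jet_apply, jet_apply]
  simp only [Module.End.mul_apply]
  rw [pderiv_scaleFun_trd, map_smul, map_smul, map_smul, pderiv_scaleFun_snd, map_smul, map_smul,
    pderiv_scaleFun_fst, map_smul, e]
  simp only [smul_eq_mul]; ring

end Scale

/-- The vector field on `ℝ³` by which the strictly upper triangular matrices of `H` act. -/
def unipotentField (κ : ℂ) : Module.End ℂ smoothFun :=
  κ • mulForm coordX - mulForm coordX * mulForm coordX * pderiv (1, 0, 0) +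
    (mulForm coordX * mulForm coordY - mulForm coordZ) * pderiv (0, 1, 0) -
    mulForm coordX * mulForm coordZ * pderiv (0, 0, 1)

/-- The transpose of the vector field on derivatives at the origin. Only two jets occur, so
invariance becomes a two-term recurrence. -/
theorem jet_unipotentField (κ : ℂ) (a b c : ℕ) (φ : smoothFun) :
    jet a b c (unipotentField κ φ) =
      a * (κ - a + 1 + b - c) * jet (a - 1) b c φ - c * jet a (b + 1) (c - 1) φ := by
  simp only [unipotentField, LinearMap.add_apply, LinearMap.sub_apply, LinearMap.smul_apply,
    Module.End.mul_apply, map_add, map_sub, map_smul, jet_coordX, jet_coordY, jet_coordZ,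
    jet_pderiv_fst, jet_pderiv_snd, jet_pderiv_trd, smul_eq_mul]
  have e1 : ((a - 1 : ℕ) : ℂ) * jet (a - 1 - 1 + 1) b c φ = ((a - 1 : ℕ) : ℂ) * jet (a - 1) b c φ := by
    rcases a with _ | _ | a <;> simp
  have e2 : (b : ℂ) * jet (a - 1) (b - 1 + 1) c φ = b * jet (a - 1) b c φ := by
    rcases b with _ | b <;> simp
  have e3 : (c : ℂ) * jet (a - 1) b (c - 1 + 1) φ = c * jet (a - 1) b c φ := by
    rcases c with _ | c <;> simp
  have e4 : (a : ℂ) * ((a - 1 : ℕ) : ℂ) = a * (a - 1) := by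
    rcases a with _ | a <;> simp
  rw [e1, e2, e3]
  linear_combination (-jet (a - 1) b c φ) * e4

/-- The matrix `diag(A, 1) n̄(x, y, z)`. -/
def cellMatrix (w : Matrix (Fin 2) (Fin 2) ℝ × ℝ × ℝ × ℝ) : Matrix (Fin 3) (Fin 3) ℝ :=
  !![w.1 0 0 + w.1 0 1 * w.2.1, w.1 0 1, 0; w.1 1 0 + w.1 1 1 * w.2.1, w.1 1 1, 0;
    w.2.2.2, w.2.2.1, 1]

theorem coe_embedH_mul_nbar (h : GL (Fin 2) ℝ) (x y z : ℝ) :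
    ((embedH 2 h * nbar x y z : GL (Fin 3) ℝ) : Matrix (Fin 3) (Fin 3) ℝ) =
      cellMatrix (h, x, y, z) := by
  rw [Units.val_mul, coe_embedH, coe_nbar]
  ext i j
  fin_cases i <;> fin_cases j <;>
    simp [embedMatrix, cellMatrix, Matrix.mul_apply, Fin.sum_univ_three]

theorem det_cellMatrix (w : Matrix (Fin 2) (Fin 2) ℝ × ℝ × ℝ × ℝ) :
    (cellMatrix w).det = w.1.det := by
  simp [cellMatrix, Matrix.det_fin_three, Matrix.det_fin_two]; ring

section
open scoped Matrix.Norms.Elementwise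

theorem contDiff_cellMatrix : ContDiff ℝ ∞ cellMatrix := by
  have ce : ∀ i j : Fin 2, ContDiff ℝ ∞
      (fun w : Matrix (Fin 2) (Fin 2) ℝ × ℝ × ℝ × ℝ => w.1 i j) := fun i j =>
    (contDiff_matrix_entry i j).comp contDiff_fst
  refine contDiff_pi.2 fun i => contDiff_pi.2 fun j => ?_
  fin_cases i <;> fin_cases j
  · exact (ce 0 0).add ((ce 0 1).mul (by fun_prop))
  · exact ce 0 1
  · exact contDiff_const
  · exact (ce 1 0).add ((ce 1 1).mul (by fun_prop))
  · exact ce 1 1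
  · exact contDiff_const
  · exact (contDiff_snd.comp (contDiff_snd.comp contDiff_snd))
  · exact (contDiff_fst.comp (contDiff_snd.comp contDiff_snd))
  · exact contDiff_const

theorem isOpen_cellDomain :
    IsOpen {w : Matrix (Fin 2) (Fin 2) ℝ × ℝ × ℝ × ℝ | IsUnit w.1} :=
  isOpen_isUnit_matrix.preimage continuous_fst

theorem contDiffOn_comp_cellMatrix {F : Matrix (Fin 3) (Fin 3) ℝ → ℂ}
    (hF : ContDiffOn ℝ ∞ F {A | IsUnit A}) :
    ContDiffOn ℝ ∞ (fun w => F (cellMatrix w)) {w | IsUnit w.1} := by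
  refine hF.comp contDiff_cellMatrix.contDiffOn fun w hw => ?_
  have hw : IsUnit w.1 := hw
  change IsUnit _
  rw [isUnit_matrix_iff] at hw ⊢
  rwa [det_cellMatrix]

variable {ξ : Fin 3 → ZMod 2} {lam : Fin 3 → ℂ}

/-- The restriction of `f` to the lower triangular unipotent matrices. -/
def chart (ξ : Fin 3 → ZMod 2) (lam : Fin 3 → ℂ) : principalSeries ξ lam →ₗ[ℂ] smoothFun where
  toFun f := ⟨fun u => (f : GL (Fin 3) ℝ → ℂ) (nbar u.1 u.2.1 u.2.2), by
    obtain ⟨F, hF, hf⟩ := f.2.1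
    have h := (contDiffOn_comp_cellMatrix hF).comp
      (f := fun u : ℝ × ℝ × ℝ => ((1 : Matrix (Fin 2) (Fin 2) ℝ), u)) (s := Set.univ)
      (by fun_prop) (fun u _ => isUnit_one)
    have h' : ContDiff ℝ ∞ _ := contDiffOn_univ.1 h
    change ContDiff ℝ ∞ (fun u : ℝ × ℝ × ℝ => (f : GL (Fin 3) ℝ → ℂ) (nbar u.1 u.2.1 u.2.2))
    convert h' using 1
    funext u
    have e := coe_embedH_mul_nbar 1 u.1 u.2.1 u.2.2
    rw [map_one, one_mul] at e
    rw [← hf, e]; rfl⟩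
  map_add' _ _ := rfl
  map_smul' _ _ := rfl

/-- The function `g ↦ f (diag(h, 1) g)`. -/
def translate (ξ : Fin 3 → ZMod 2) (lam : Fin 3 → ℂ) (h : GL (Fin 2) ℝ) :
    principalSeries ξ lam →ₗ[ℂ] principalSeries ξ lam := leftRegular ξ lam (embedH 2 h)⁻¹

theorem translate_apply (h : GL (Fin 2) ℝ) (f : principalSeries ξ lam) (g : GL (Fin 3) ℝ) :
    (translate ξ lam h f : GL (Fin 3) ℝ → ℂ) g = (f : GL (Fin 3) ℝ → ℂ) (embedH 2 h * g) := by
  change (f : GL (Fin 3) ℝ → ℂ) ((embedH 2 h)⁻¹⁻¹ * g) = _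
  rw [inv_inv]

theorem translate_mul (h k : GL (Fin 2) ℝ) (f : principalSeries ξ lam) :
    translate ξ lam (h * k) f = translate ξ lam k (translate ξ lam h f) := by
  ext g
  simp only [translate_apply, map_mul, mul_assoc]

theorem translate_one (f : principalSeries ξ lam) : translate ξ lam 1 f = f := by
  ext g
  rw [translate_apply, map_one, one_mul]

theorem chart_apply (f : principalSeries ξ lam) (x y z : ℝ) :
    (chart ξ lam f : ℝ × ℝ × ℝ → ℂ) (x, y, z) = (f : GL (Fin 3) ℝ → ℂ) (nbar x y z) := rfl

theorem chart_translate_apply (h : GL (Fin 2) ℝ) (f : principalSeries ξ lam) (x y z : ℝ) :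
    (chart ξ lam (translate ξ lam h f) : ℝ × ℝ × ℝ → ℂ) (x, y, z) =
      (f : GL (Fin 3) ℝ → ℂ) (embedH 2 h * nbar x y z) := by
  rw [chart_apply, translate_apply]

theorem exists_chart_eq (ξ : Fin 3 → ZMod 2) (lam : Fin 3 → ℂ) (φ : smoothFun)
    (hs : HasCompactSupport (φ : ℝ × ℝ × ℝ → ℂ)) : ∃ f, chart ξ lam f = φ := by
  obtain ⟨f, hf⟩ := exists_principalSeries_of_hasCompactSupport ξ lam (contDiff_coe φ) hs
  exact ⟨f, Subtype.ext (funext fun ⟨x, y, z⟩ => hf x y z)⟩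

/-- One function on matrices times `ℝ³` carries both the translation and the coordinates. Jets are
then mixed partials of it at `(h, 0)`: they are smooth in `h` and commute with differentiation in
`h`. -/
theorem jet_chart_translate_eq {F : Matrix (Fin 3) (Fin 3) ℝ → ℂ}
    (hF : ContDiffOn ℝ ∞ F {A | IsUnit A}) (f : principalSeries ξ lam)
    (hf : ∀ g : GL (Fin 3) ℝ, F (g : Matrix (Fin 3) (Fin 3) ℝ) = (f : GL (Fin 3) ℝ → ℂ) g)
    (a b c : ℕ) (h : GL (Fin 2) ℝ) :
    jet a b c (chart ξ lam (translate ξ lam h f)) =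
      mixedDeriv (0, 1, 0, 0) (0, 0, 1, 0) (0, 0, 0, 1) a b c (fun w => F (cellMatrix w))
        ((h : Matrix (Fin 2) (Fin 2) ℝ), 0) := by
  have h1 := deltaDeriv_eq_jet a b c (chart ξ lam (translate ξ lam h f))
  have h2 := deltaDeriv_eq_mixedDeriv ((h : Matrix (Fin 2) (Fin 2) ℝ), (0 : ℝ × ℝ × ℝ))
    (0, 1, 0, 0) (0, 0, 1, 0) (0, 0, 0, 1) isOpen_cellDomain (contDiffOn_comp_cellMatrix hF)
    (fun x y z => by simp) a b c
  have h0 : ((-1 : ℂ)) ^ (a + b + c) ≠ 0 := pow_ne_zero _ (by norm_num)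
  refine mul_left_cancel₀ h0 ?_
  rw [← h1, ← h2]
  congr 1
  ext x y z
  rw [chart_translate_apply, ← hf, coe_embedH_mul_nbar]
  simp

theorem isSmooth_jet_chart_translate (a b c : ℕ) (f : principalSeries ξ lam) :
    IsSmooth (fun h => jet a b c (chart ξ lam (translate ξ lam h f))) := by
  obtain ⟨F, hF, hf⟩ := f.2.1
  refine ⟨fun A => mixedDeriv (0, 1, 0, 0) (0, 0, 1, 0) (0, 0, 0, 1) a b c
    (fun w => F (cellMatrix w)) (A, 0), ?_, fun h => (jet_chart_translate_eq hF f hf a b c h).symm⟩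
  refine (contDiffOn_mixedDeriv _ _ _ a b c isOpen_cellDomain
    (contDiffOn_comp_cellMatrix hF)).comp (f := fun A => (A, (0 : ℝ × ℝ × ℝ))) (by fun_prop)
    fun A hA => hA

/-! ### Diagonal and unipotent elements of `H` acting in the chart -/

/-- The diagonal matrices of `GL 2 ℝ`. -/
def diagH (p q : ℝ) (h : p * q ≠ 0) : GL (Fin 2) ℝ :=
  Matrix.GeneralLinearGroup.mkOfDetNeZero !![p, 0; 0, q] (by simpa [Matrix.det_fin_two] using h)

/-- The upper triangular unipotent matrices of `GL 2 ℝ`. -/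
def unipH (s : ℝ) : GL (Fin 2) ℝ :=
  Matrix.GeneralLinearGroup.mkOfDetNeZero !![1, s; 0, 1] (by simp [Matrix.det_fin_two])

theorem coe_diagH (p q : ℝ) (h : p * q ≠ 0) :
    (diagH p q h : Matrix (Fin 2) (Fin 2) ℝ) = !![p, 0; 0, q] := rfl

theorem coe_unipH (s : ℝ) : (unipH s : Matrix (Fin 2) (Fin 2) ℝ) = !![1, s; 0, 1] := rfl

theorem unipH_zero : unipH 0 = 1 := by
  ext i j
  rw [coe_unipH]
  fin_cases i <;> fin_cases j <;> simp

theorem unipH_add (s t : ℝ) : unipH (s + t) = unipH s * unipH t := by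
  refine Units.ext ?_
  rw [Units.val_mul, coe_unipH, coe_unipH, coe_unipH, Matrix.mul_fin_two]
  simp [add_comm]

/-- An upper triangular matrix of `GL 3 ℝ` commuting with the coordinate `z₃`. -/
def upperG (p q t : ℝ) (h : p * q ≠ 0) : GL (Fin 3) ℝ :=
  Matrix.GeneralLinearGroup.mkOfDetNeZero !![p, t, 0; 0, q, 0; 0, 0, 1]
    (by simpa [Matrix.det_fin_three] using h)

theorem apply_mul_upperG (f : principalSeries ξ lam) (g : GL (Fin 3) ℝ) (p q t : ℝ)
    (h : p * q ≠ 0) : (f : GL (Fin 3) ℝ → ℂ) (g * upperG p q t h) =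
      signedPow (ξ 0) (-lam 0 - 1) p * signedPow (ξ 1) (-lam 1) q *
        (f : GL (Fin 3) ℝ → ℂ) g := by
  rw [f.2.2 g (upperG p q t h), Fin.prod_univ_three]
  · simp [upperG, rho_three, signedPow_one]
  · intro i j hij
    fin_cases i <;> fin_cases j <;> simp [upperG] at hij ⊢

theorem chart_translate_diagH (p q : ℝ) (h : p * q ≠ 0) (f : principalSeries ξ lam) :
    chart ξ lam (translate ξ lam (diagH p q h) f) =
      (signedPow (ξ 0) (-lam 0 - 1) p * signedPow (ξ 1) (-lam 1) q) •
        scaleFun (q / p) q⁻¹ p⁻¹ (chart ξ lam f) := by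
  have hp := left_ne_zero_of_mul h
  have hq := right_ne_zero_of_mul h
  refine Subtype.ext (funext fun ⟨x, y, z⟩ => ?_)
  rw [chart_translate_apply]
  have e : embedH 2 (diagH p q h) * nbar x y z =
      nbar (q / p * x) (q⁻¹ * y) (p⁻¹ * z) * upperG p q 0 h := by
    refine Units.ext ?_
    rw [coe_embedH_mul_nbar, Units.val_mul, coe_nbar, coe_diagH]
    ext i j
    fin_cases i <;> fin_cases j <;>
      simp [cellMatrix, upperG, Matrix.mul_apply, Fin.sum_univ_three] <;> field_simp
  rw [e, apply_mul_upperG]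
  rfl

/-- Factoring the translated matrix again as lower unipotent times upper triangular produces the
pivots `1 + t x` and `(1 + t x)⁻¹`. Their characters combine to the exponent `λ₂ - λ₁ - 1`. -/
theorem chart_translate_unipH (t x y z : ℝ) (ht : 0 < 1 + t * x) (f : principalSeries ξ lam) :
    (chart ξ lam (translate ξ lam (unipH t) f) : ℝ × ℝ × ℝ → ℂ) (x, y, z) =
      ((1 + t * x : ℝ) : ℂ) ^ (lam 1 - lam 0 - 1) *
        (chart ξ lam f : ℝ × ℝ × ℝ → ℂ)
          (x / (1 + t * x), (1 + t * x) * y - t * z, z / (1 + t * x)) := by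
  have h0 : (1 + t * x) * (1 + t * x)⁻¹ ≠ 0 := by rw [mul_inv_cancel₀ ht.ne']; exact one_ne_zero
  rw [chart_translate_apply, chart_apply]
  have e : embedH 2 (unipH t) * nbar x y z =
      nbar (x / (1 + t * x)) ((1 + t * x) * y - t * z) (z / (1 + t * x)) *
        upperG (1 + t * x) (1 + t * x)⁻¹ t h0 := by
    refine Units.ext ?_
    rw [coe_embedH_mul_nbar, Units.val_mul, coe_nbar, coe_unipH]
    have hne := ht.ne'
    have e1 : x / (1 + t * x) * (1 + t * x) = x := div_mul_cancel₀ x hne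
    have e2 : z / (1 + t * x) * (1 + t * x) = z := div_mul_cancel₀ z hne
    have e3 : (1 + t * x) * (1 + t * x)⁻¹ = 1 := mul_inv_cancel₀ hne
    ext i j
    fin_cases i <;> fin_cases j <;>
      simp [cellMatrix, upperG, Matrix.mul_apply, Fin.sum_univ_three, e1, e2]
    · rw [div_eq_mul_inv]; linear_combination -e3
    · rw [div_eq_mul_inv]; linear_combination -y * e3
  rw [e, apply_mul_upperG, signedPow_of_pos _ _ ht, signedPow_of_pos _ _ (inv_pos.2 ht)]
  congr 1
  have hc : ((1 + t * x : ℝ) : ℂ) ≠ 0 := by exact_mod_cast ht.ne'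
  have ha : ((1 + t * x : ℝ) : ℂ).arg ≠ Real.pi := by
    rw [Complex.arg_ofReal_of_nonneg ht.le]; exact Real.pi_pos.ne
  rw [Complex.ofReal_inv, Complex.inv_cpow _ _ ha, ← Complex.cpow_neg, ← Complex.cpow_add _ _ hc]
  congr 1; ring

theorem hasDerivAt_chart_translate_unipH (f : principalSeries ξ lam) (x y z : ℝ) :
    HasDerivAt (fun t => (chart ξ lam (translate ξ lam (unipH t) f) : ℝ × ℝ × ℝ → ℂ) (x, y, z))
      ((unipotentField (lam 1 - lam 0 - 1) (chart ξ lam f) : ℝ × ℝ × ℝ → ℂ) (x, y, z)) 0 := by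
  set κ := lam 1 - lam 0 - 1
  set φ := chart ξ lam f
  have hw : HasDerivAt (fun t : ℝ => 1 + t * x) x 0 := by
    simpa using ((hasDerivAt_id (0 : ℝ)).mul_const x).const_add 1
  have hw0 : (1 : ℝ) + 0 * x ≠ 0 := by simp
  have h1 : HasDerivAt (fun t : ℝ => ((1 + t * x : ℝ) : ℂ) ^ κ) (κ * x) 0 := by
    have h := HasDerivAt.scomp (0 : ℝ) (g₁ := fun w : ℂ => w ^ κ)
      (h := fun t : ℝ => ((1 + t * x : ℝ) : ℂ))
      (Complex.hasStrictDerivAt_cpow_const (by simp)).hasDerivAt hw.ofReal_comp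
    simpa [Function.comp_def, mul_comm] using h
  -- The velocity at `t = 0` of the fractional linear action gives the first-order part of
  -- `unipotentField`.
  have h2 : HasDerivAt (fun t : ℝ =>
      (x / (1 + t * x), (1 + t * x) * y - t * z, z / (1 + t * x))) (-x ^ 2, x * y - z, -(x * z))
      (0 : ℝ) := by
    refine HasDerivAt.prodMk ?_ (HasDerivAt.prodMk ?_ ?_)
    · have := (hasDerivAt_const (0 : ℝ) x).fun_div hw hw0
      exact this.congr_deriv (by ring)
    · simpa using (hw.mul_const y).fun_sub ((hasDerivAt_id (0 : ℝ)).mul_const z)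
    · have := (hasDerivAt_const (0 : ℝ) z).fun_div hw hw0
      exact this.congr_deriv (by ring)
  have h3 : HasDerivAt (fun t : ℝ => (φ : ℝ × ℝ × ℝ → ℂ)
      (x / (1 + t * x), (1 + t * x) * y - t * z, z / (1 + t * x)))
      (fderiv ℝ (φ : ℝ × ℝ × ℝ → ℂ) (x, y, z) (-x ^ 2, x * y - z, -(x * z))) 0 := by
    have := (differentiableAt_coe φ (x / (1 + 0 * x), (1 + 0 * x) * y - 0 * z,
      z / (1 + 0 * x))).hasFDerivAt.comp_hasDerivAt (0 : ℝ) h2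
    simpa [Function.comp_def] using this
  have h4 := h1.fun_mul h3
  have h5 : (unipotentField κ φ : ℝ × ℝ × ℝ → ℂ) (x, y, z) =
      κ * x * (φ : ℝ × ℝ × ℝ → ℂ) (x, y, z) +
        fderiv ℝ (φ : ℝ × ℝ × ℝ → ℂ) (x, y, z) (-x ^ 2, x * y - z, -(x * z)) := by
    have e : fderiv ℝ (φ : ℝ × ℝ × ℝ → ℂ) (x, y, z) (-x ^ 2, x * y - z, -(x * z)) =
        (pderiv (-x ^ 2, x * y - z, -(x * z)) φ : ℝ × ℝ × ℝ → ℂ) (x, y, z) := rfl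
    rw [e, pderiv_add_smul]
    change κ * ((x : ℂ) * _) - (x : ℂ) * ((x : ℂ) * _) + ((x : ℂ) * ((y : ℂ) * _) - (z : ℂ) * _) -
      (x : ℂ) * ((z : ℂ) * _) = _ + (((-x ^ 2 : ℝ) : ℂ) * _ + ((x * y - z : ℝ) : ℂ) * _ +
        ((-(x * z) : ℝ) : ℂ) * _)
    push_cast
    ring
  rw [h5]
  have h6 : HasDerivAt (fun t : ℝ => ((1 + t * x : ℝ) : ℂ) ^ κ * (φ : ℝ × ℝ × ℝ → ℂ)
      (x / (1 + t * x), (1 + t * x) * y - t * z, z / (1 + t * x)))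
      (κ * x * (φ : ℝ × ℝ × ℝ → ℂ) (x, y, z) +
        fderiv ℝ (φ : ℝ × ℝ × ℝ → ℂ) (x, y, z) (-x ^ 2, x * y - z, -(x * z))) 0 := by
    exact h4.congr_deriv (by simp)
  refine h6.congr_of_eventuallyEq ?_
  have hpos : ∀ᶠ t in nhds (0 : ℝ), 0 < 1 + t * x :=
    hw.continuousAt.eventually (lt_mem_nhds (by simp))
  filter_upwards [hpos] with t ht
  exact chart_translate_unipH t x y z ht f

/-- The derivative in `s` commutes with the partial derivatives in `x, y, z` that form the jet, and
it acts pointwise by the vector field. -/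
theorem hasDerivAt_jet_chart_translate_unipH (f : principalSeries ξ lam) (a b c : ℕ) (s : ℝ) :
    HasDerivAt (fun s => jet a b c (chart ξ lam (translate ξ lam (unipH s) f)))
      (jet a b c (unipotentField (lam 1 - lam 0 - 1)
        (chart ξ lam (translate ξ lam (unipH s) f)))) s := by
  obtain ⟨F, hF, hf⟩ := f.2.1
  set Φ : Matrix (Fin 2) (Fin 2) ℝ × ℝ × ℝ × ℝ → ℂ := fun w => F (cellMatrix w)
  have hΦ : ContDiffOn ℝ ∞ Φ {w | IsUnit w.1} := contDiffOn_comp_cellMatrix hF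
  have hO := isOpen_cellDomain
  set N : Matrix (Fin 2) (Fin 2) ℝ := !![0, 1; 0, 0]
  have hline : ∀ (u : ℝ × ℝ × ℝ) (s : ℝ), HasDerivAt
      (fun s => ((unipH s : Matrix (Fin 2) (Fin 2) ℝ), u)) (N, (0 : ℝ × ℝ × ℝ)) s := fun u s => by
    have e : (fun s => ((unipH s : Matrix (Fin 2) (Fin 2) ℝ), u)) =
        fun s : ℝ => ((1 : Matrix (Fin 2) (Fin 2) ℝ), u) + s • (N, (0 : ℝ × ℝ × ℝ)) := by
      funext s
      refine Prod.ext ?_ (by simp)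
      rw [coe_unipH]
      ext i j
      fin_cases i <;> fin_cases j <;> simp [N]
    rw [e]
    have := ((hasDerivAt_id s).smul_const (N, (0 : ℝ × ℝ × ℝ))).const_add
      ((1 : Matrix (Fin 2) (Fin 2) ℝ), u)
    rw [one_smul] at this
    exact this
  have hmem : ∀ (u : ℝ × ℝ × ℝ) (s : ℝ), ((unipH s : Matrix (Fin 2) (Fin 2) ℝ), u) ∈
      {w : Matrix (Fin 2) (Fin 2) ℝ × ℝ × ℝ × ℝ | IsUnit w.1} := fun u s => (unipH s).isUnit
  have hder : ∀ G : Matrix (Fin 2) (Fin 2) ℝ × ℝ × ℝ × ℝ → ℂ, ContDiffOn ℝ ∞ G {w | IsUnit w.1} →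
      ∀ (u : ℝ × ℝ × ℝ) (s : ℝ), HasDerivAt (fun s => G ((unipH s : Matrix (Fin 2) (Fin 2) ℝ), u))
        (dirDeriv (N, 0) G ((unipH s : Matrix (Fin 2) (Fin 2) ℝ), u)) s := fun G hG u s =>
    ((hG.contDiffAt (hO.mem_nhds (hmem u s))).differentiableAt
      (by simp)).hasFDerivAt.comp_hasDerivAt s (hline u s)
  -- The one-parameter group law moves the derivative at `s` to the derivative at `0` for the
  -- translated function.
  have hslice : ∀ x y z : ℝ, dirDeriv (N, 0) Φ ((unipH s : Matrix (Fin 2) (Fin 2) ℝ), x, y, z) =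
      (unipotentField (lam 1 - lam 0 - 1) (chart ξ lam (translate ξ lam (unipH s) f)) :
        ℝ × ℝ × ℝ → ℂ) (x, y, z) := fun x y z => by
    have h1 := hder Φ hΦ (x, y, z) s
    have h2 := hasDerivAt_chart_translate_unipH (translate ξ lam (unipH s) f) x y z
    have e : (fun t => (chart ξ lam (translate ξ lam (unipH t) (translate ξ lam (unipH s) f)) :
        ℝ × ℝ × ℝ → ℂ) (x, y, z)) =
        fun t => Φ ((unipH (s + t) : Matrix (Fin 2) (Fin 2) ℝ), x, y, z) := by
      funext t
      rw [← translate_mul, ← unipH_add, chart_translate_apply, ← hf, coe_embedH_mul_nbar]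
    rw [e] at h2
    have h3 : HasDerivAt (fun t => Φ ((unipH (s + t) : Matrix (Fin 2) (Fin 2) ℝ), x, y, z))
        (dirDeriv (N, 0) Φ ((unipH s : Matrix (Fin 2) (Fin 2) ℝ), x, y, z)) 0 := by
      have h1' : HasDerivAt (fun s => Φ ((unipH s : Matrix (Fin 2) (Fin 2) ℝ), x, y, z))
        (dirDeriv (N, 0) Φ ((unipH s : Matrix (Fin 2) (Fin 2) ℝ), x, y, z)) (s + 0) := by
        rwa [add_zero]
      exact h1'.comp_const_add s 0
    exact h3.unique h2
  have h1 := hder _ (contDiffOn_mixedDeriv (0, 1, 0, 0) (0, 0, 1, 0) (0, 0, 0, 1) a b c hO hΦ) 0 s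
  rw [dirDeriv_mixedDeriv _ _ _ _ _ _ _ hO hΦ (hmem 0 s)] at h1
  have h2 := deltaDeriv_eq_mixedDeriv ((unipH s : Matrix (Fin 2) (Fin 2) ℝ), (0 : ℝ × ℝ × ℝ))
    (0, 1, 0, 0) (0, 0, 1, 0) (0, 0, 0, 1) hO (contDiffOn_dirDeriv (N, 0) hO hΦ)
    (fun x y z => by simp) a b c
  have h3 := deltaDeriv_eq_jet a b c (unipotentField (lam 1 - lam 0 - 1)
    (chart ξ lam (translate ξ lam (unipH s) f)))
  have h0 : ((-1 : ℂ)) ^ (a + b + c) ≠ 0 := pow_ne_zero _ (by norm_num)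
  have h4 : mixedDeriv (0, 1, 0, 0) (0, 0, 1, 0) (0, 0, 0, 1) a b c (dirDeriv (N, 0) Φ)
      ((unipH s : Matrix (Fin 2) (Fin 2) ℝ), 0) = jet a b c (unipotentField (lam 1 - lam 0 - 1)
        (chart ξ lam (translate ξ lam (unipH s) f))) := by
    refine mul_left_cancel₀ h0 ?_
    rw [← h2, ← h3]
    congr 1
    ext x y z
    rw [← hslice]
    simp
  rw [h4] at h1
  simp only [jet_chart_translate_eq hF f hf]
  exact h1

end

/-! ### The structure of differential symmetry breaking operators -/

section Support

variable {ξ : Fin 3 → ZMod 2} {lam : Fin 3 → ℂ}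

theorem continuous_coe_entry {n : ℕ} (i j : Fin n) :
    Continuous fun g : GL (Fin n) ℝ => (g : Matrix (Fin n) (Fin n) ℝ) i j :=
  Units.continuous_val.matrix_elem i j

theorem exists_eq_nbar_mul_upper (g : GL (Fin 3) ℝ)
    (ha : (g : Matrix (Fin 3) (Fin 3) ℝ) 0 0 ≠ 0)
    (hd : (g : Matrix (Fin 3) (Fin 3) ℝ) 0 0 * (g : Matrix (Fin 3) (Fin 3) ℝ) 1 1 -
      (g : Matrix (Fin 3) (Fin 3) ℝ) 0 1 * (g : Matrix (Fin 3) (Fin 3) ℝ) 1 0 ≠ 0) :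
    ∃ p : GL (Fin 3) ℝ, IsUpper p ∧
      g = nbar ((g : Matrix (Fin 3) (Fin 3) ℝ) 1 0 / (g : Matrix (Fin 3) (Fin 3) ℝ) 0 0)
        (((g : Matrix (Fin 3) (Fin 3) ℝ) 0 0 * (g : Matrix (Fin 3) (Fin 3) ℝ) 2 1 -
            (g : Matrix (Fin 3) (Fin 3) ℝ) 2 0 * (g : Matrix (Fin 3) (Fin 3) ℝ) 0 1) /
          ((g : Matrix (Fin 3) (Fin 3) ℝ) 0 0 * (g : Matrix (Fin 3) (Fin 3) ℝ) 1 1 -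
            (g : Matrix (Fin 3) (Fin 3) ℝ) 0 1 * (g : Matrix (Fin 3) (Fin 3) ℝ) 1 0))
        ((g : Matrix (Fin 3) (Fin 3) ℝ) 2 0 / (g : Matrix (Fin 3) (Fin 3) ℝ) 0 0) * p := by
  have hg := det_ne_zero g
  set M : Matrix (Fin 3) (Fin 3) ℝ := (g : Matrix (Fin 3) (Fin 3) ℝ) with hM
  set a := M 0 0
  set d := a * M 1 1 - M 0 1 * M 1 0 with hd'
  set N := a * M 2 1 - M 2 0 * M 0 1 with hN
  have e10 : M 1 0 / a * a = M 1 0 := div_mul_cancel₀ _ ha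
  have e20 : M 2 0 / a * a = M 2 0 := div_mul_cancel₀ _ ha
  have e11 : M 1 0 / a * M 0 1 + d / a = M 1 1 := by
    rw [hd']; field_simp; ring
  have e21 : M 2 0 / a * M 0 1 + N / d * (d / a) = M 2 1 := by
    rw [div_mul_div_cancel₀ hd, hN]; field_simp; ring
  set P : Matrix (Fin 3) (Fin 3) ℝ := !![a, M 0 1, M 0 2; 0, d / a, M 1 2 - M 1 0 / a * M 0 2;
    0, 0, M 2 2 - M 2 0 / a * M 0 2 - N / d * (M 1 2 - M 1 0 / a * M 0 2)] with hP
  have key : M = (nbar (M 1 0 / a) (N / d) (M 2 0 / a) : Matrix (Fin 3) (Fin 3) ℝ) * P := by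
    rw [coe_nbar]
    ext i j
    fin_cases i <;> fin_cases j <;>
      simp [hP, Matrix.mul_apply, Fin.sum_univ_three, e10, e20, e11, e21, a]
  have hPd : P.det ≠ 0 := fun h => hg (by rw [key, Matrix.det_mul, h, mul_zero])
  refine ⟨Matrix.GeneralLinearGroup.mkOfDetNeZero P hPd, ?_, Units.ext ?_⟩
  · intro i j hij
    change P i j = 0
    fin_cases i <;> fin_cases j <;> simp [hP] at hij ⊢
  · exact key

/-- Near the identity every `g` factors as `n̄ p` with the coordinates of `n̄` close to `0`, and
equivariance carries the vanishing from `n̄` to `g`. -/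
theorem one_notMem_tsupport {f : principalSeries ξ lam}
    (h : (chart ξ lam f : ℝ × ℝ × ℝ → ℂ) =ᶠ[nhds 0] 0) :
    (1 : GL (Fin 3) ℝ) ∉ tsupport (f : GL (Fin 3) ℝ → ℂ) := by
  rw [notMem_tsupport_iff_eventuallyEq]
  have ce := continuous_coe_entry (n := 3)
  have cd : Continuous fun g : GL (Fin 3) ℝ => (g : Matrix (Fin 3) (Fin 3) ℝ) 0 0 *
      (g : Matrix (Fin 3) (Fin 3) ℝ) 1 1 -
      (g : Matrix (Fin 3) (Fin 3) ℝ) 0 1 * (g : Matrix (Fin 3) (Fin 3) ℝ) 1 0 :=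
    ((ce 0 0).mul (ce 1 1)).sub ((ce 0 1).mul (ce 1 0))
  have cN : Continuous fun g : GL (Fin 3) ℝ => (g : Matrix (Fin 3) (Fin 3) ℝ) 0 0 *
      (g : Matrix (Fin 3) (Fin 3) ℝ) 2 1 -
      (g : Matrix (Fin 3) (Fin 3) ℝ) 2 0 * (g : Matrix (Fin 3) (Fin 3) ℝ) 0 1 :=
    ((ce 0 0).mul (ce 2 1)).sub ((ce 2 0).mul (ce 0 1))
  have h1 : ∀ᶠ g : GL (Fin 3) ℝ in nhds 1, (g : Matrix (Fin 3) (Fin 3) ℝ) 0 0 ≠ 0 :=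
    (ce 0 0).continuousAt.eventually (isOpen_ne.mem_nhds (by simp))
  have h2 : ∀ᶠ g : GL (Fin 3) ℝ in nhds 1, (g : Matrix (Fin 3) (Fin 3) ℝ) 0 0 *
      (g : Matrix (Fin 3) (Fin 3) ℝ) 1 1 -
      (g : Matrix (Fin 3) (Fin 3) ℝ) 0 1 * (g : Matrix (Fin 3) (Fin 3) ℝ) 1 0 ≠ 0 :=
    cd.continuousAt.eventually (isOpen_ne.mem_nhds (by simp))
  have h3 : Filter.Tendsto (fun g : GL (Fin 3) ℝ =>
      ((g : Matrix (Fin 3) (Fin 3) ℝ) 1 0 / (g : Matrix (Fin 3) (Fin 3) ℝ) 0 0,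
        ((g : Matrix (Fin 3) (Fin 3) ℝ) 0 0 * (g : Matrix (Fin 3) (Fin 3) ℝ) 2 1 -
            (g : Matrix (Fin 3) (Fin 3) ℝ) 2 0 * (g : Matrix (Fin 3) (Fin 3) ℝ) 0 1) /
          ((g : Matrix (Fin 3) (Fin 3) ℝ) 0 0 * (g : Matrix (Fin 3) (Fin 3) ℝ) 1 1 -
            (g : Matrix (Fin 3) (Fin 3) ℝ) 0 1 * (g : Matrix (Fin 3) (Fin 3) ℝ) 1 0),
        (g : Matrix (Fin 3) (Fin 3) ℝ) 2 0 / (g : Matrix (Fin 3) (Fin 3) ℝ) 0 0))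
      (nhds 1) (nhds 0) := by
    have := ((ce 1 0).continuousAt.div (ce 0 0).continuousAt (by simp)).prodMk
      ((cN.continuousAt.div cd.continuousAt (by simp)).prodMk
        ((ce 2 0).continuousAt.div (ce 0 0).continuousAt (by simp)))
      (x := (1 : GL (Fin 3) ℝ))
    rw [show (0 : ℝ × ℝ × ℝ) = (0, 0, 0) from rfl]
    simpa [ContinuousAt] using this
  filter_upwards [h1, h2, h3.eventually h] with g ha hd hg
  obtain ⟨p, hp, e⟩ := exists_eq_nbar_mul_upper g ha hd
  rw [e, f.2.2 _ p hp]
  change (f : GL (Fin 3) ℝ → ℂ) (nbar _ _ _) = 0 at hg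
  rw [hg, mul_zero]; rfl

end Support

/-! ### Localization at the identity, finite order and expansion in jets -/

section Structure

variable {ξ : Fin 3 → ZMod 2} {lam : Fin 3 → ℂ} {η : Fin 2 → ZMod 2} {ν : Fin 2 → ℂ}
  {T : principalSeries ξ lam →ₗ[ℂ] principalSeries η ν}

/-- Intertwining reduces `T` to the single functional `f ↦ T f 1`. -/
theorem DSBO.apply_eq (hT : T ∈ DSBO 2 ξ lam η ν) (f : principalSeries ξ lam)
    (h : GL (Fin 2) ℝ) : (T f : GL (Fin 2) ℝ → ℂ) h =
      (T (translate ξ lam h f) : GL (Fin 2) ℝ → ℂ) 1 := by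
  have e := LinearMap.congr_fun (hT.1 h⁻¹) f
  rw [LinearMap.comp_apply, map_inv] at e
  unfold translate
  rw [e]
  change _ = (T f : GL (Fin 2) ℝ → ℂ) (h⁻¹⁻¹ * 1)
  rw [inv_inv, mul_one]

theorem DSBO.apply_one_eq_zero (hT : T ∈ DSBO 2 ξ lam η ν) {f : principalSeries ξ lam}
    (h : (chart ξ lam f : ℝ × ℝ × ℝ → ℂ) =ᶠ[nhds 0] 0) :
    (T f : GL (Fin 2) ℝ → ℂ) 1 = 0 := by
  by_contra hne
  have := hT.2 f 1 (subset_tsupport _ hne)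
  rw [map_one, one_mul, basePoint_two_two] at this
  exact one_notMem_tsupport h this

theorem DSBO.apply_one_congr (hT : T ∈ DSBO 2 ξ lam η ν) {f g : principalSeries ξ lam}
    (h : (chart ξ lam f : ℝ × ℝ × ℝ → ℂ) =ᶠ[nhds 0] chart ξ lam g) :
    (T f : GL (Fin 2) ℝ → ℂ) 1 = (T g : GL (Fin 2) ℝ → ℂ) 1 := by
  have h0 : (T (f - g) : GL (Fin 2) ℝ → ℂ) 1 = 0 := by
    refine DSBO.apply_one_eq_zero hT ?_
    filter_upwards [h] with u hu
    rw [map_sub]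
    exact sub_eq_zero.2 hu
  rw [map_sub] at h0
  exact sub_eq_zero.1 h0

/-- The lower triangular unipotent matrices of `GL 2 ℝ`. -/
def lowerH (t : ℝ) : GL (Fin 2) ℝ :=
  Matrix.GeneralLinearGroup.mkOfDetNeZero !![1, 0; t, 1] (by simp [Matrix.det_fin_two])

theorem chart_translate_lowerH (t x y z : ℝ) (f : principalSeries ξ lam) :
    (chart ξ lam (translate ξ lam (lowerH t) f) : ℝ × ℝ × ℝ → ℂ) (x, y, z) =
      (chart ξ lam f : ℝ × ℝ × ℝ → ℂ) (x + t, y, z) := by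
  have e : embedH 2 (lowerH t) * nbar x y z = nbar (x + t) y z := by
    refine Units.ext ?_
    rw [coe_embedH_mul_nbar, coe_nbar]
    ext i j
    fin_cases i <;> fin_cases j <;> simp [cellMatrix, lowerH, add_comm]
  rw [chart_translate_apply, chart_apply, e]

section
open scoped Matrix.Norms.Elementwise

/-- Peetre's theorem: a differential symmetry breaking operator has finite order. -/
theorem DSBO.exists_order (hT : T ∈ DSBO 2 ξ lam η ν) :
    ∃ M : ℕ, ∀ f : principalSeries ξ lam,
      (∀ p ≤ M, iteratedFDeriv ℝ p (chart ξ lam f : ℝ × ℝ × ℝ → ℂ) 0 = 0) →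
        (T f : GL (Fin 2) ℝ → ℂ) 1 = 0 := by
  by_contra! H
  choose f hf hne using H
  -- Rescaling keeps the vanishing jets and prescribes the unbounded values `T (g k) 1 = k`.
  set g : ℕ → principalSeries ξ lam := fun k =>
    ((k : ℂ) / (T (f k) : GL (Fin 2) ℝ → ℂ) 1) • f k with hg
  have hTg : ∀ k, (T (g k) : GL (Fin 2) ℝ → ℂ) 1 = k := fun k => by
    simp only [hg, map_smul]
    exact div_mul_cancel₀ _ (hne k)
  have hgj : ∀ k, ∀ p ≤ k,
      iteratedFDeriv ℝ p (chart ξ lam (g k) : ℝ × ℝ × ℝ → ℂ) 0 = 0 := fun k p hp => by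
    have e : (chart ξ lam (g k) : ℝ × ℝ × ℝ → ℂ) =
        ((k : ℂ) / (T (f k) : GL (Fin 2) ℝ → ℂ) 1) • (chart ξ lam (f k) : ℝ × ℝ × ℝ → ℂ) := by
      simp only [hg, map_smul]; rfl
    rw [e, iteratedFDeriv_const_smul_apply
      ((contDiff_coe _).contDiffAt.of_le (by exact_mod_cast le_top)), hf k p hp, smul_zero]
  -- The points are spread along the `x`-axis because `lowerH t` in `H` acts on the chart as the
  -- translation `x ↦ x + t`.
  obtain ⟨Φ, hΦ, hΦs, hΦg⟩ := exists_smooth_gluing ((1, 0, 0) : ℝ × ℝ × ℝ) (by simp)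
    (fun k => (chart ξ lam (g k) : ℝ × ℝ × ℝ → ℂ)) (fun k => contDiff_coe _) hgj
  obtain ⟨F, hF⟩ := exists_chart_eq ξ lam ⟨Φ, hΦ⟩ hΦs
  have hval : ∀ k : ℕ, (T F : GL (Fin 2) ℝ → ℂ) (lowerH ((1 / 2) ^ k)) = k := fun k => by
    rw [DSBO.apply_eq hT, ← hTg k]
    refine DSBO.apply_one_congr hT ?_
    filter_upwards [hΦg k] with u hu
    obtain ⟨x, y, z⟩ := u
    rw [chart_translate_lowerH, hF, ← hu]
    simp
  obtain ⟨G, hG, hGe⟩ := (T F).2.1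
  have hcont : ContinuousAt G 1 :=
    (hG.contDiffAt (isOpen_isUnit_matrix.mem_nhds isUnit_one)).continuousAt
  have hpath : Filter.Tendsto (fun k : ℕ => (lowerH ((1 / 2) ^ k) : Matrix (Fin 2) (Fin 2) ℝ))
      Filter.atTop (nhds 1) := by
    have hp : Continuous fun t : ℝ => (lowerH t : Matrix (Fin 2) (Fin 2) ℝ) := by
      refine continuous_matrix fun i j => ?_
      fin_cases i <;> fin_cases j
      · exact continuous_const
      · exact continuous_const
      · exact continuous_id
      · exact continuous_const
    have h0 : (lowerH 0 : Matrix (Fin 2) (Fin 2) ℝ) = 1 := by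
      ext i j
      fin_cases i <;> fin_cases j <;> simp [lowerH]
    have := (hp.tendsto 0).comp (tendsto_pow_atTop_nhds_zero_of_lt_one
      (by norm_num : (0 : ℝ) ≤ 1 / 2) (by norm_num))
    rwa [h0] at this
  have hlim := (hcont.tendsto.comp hpath).norm
  -- The values `k` of `T F` at points tending to the identity contradict its continuity there.
  refine not_tendsto_nhds_of_tendsto_atTop (tendsto_natCast_atTop_atTop (R := ℝ)) ‖G 1‖
    (hlim.congr fun k => ?_)
  rw [Function.comp_apply, hGe, hval]
  simp

end

/-- Elements of the principal series dual to the derivatives at the identity. -/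
theorem exists_dual (ξ : Fin 3 → ZMod 2) (lam : Fin 3 → ℂ) (t : ℕ × ℕ × ℕ) :
    ∃ f : principalSeries ξ lam, ∀ a b c,
      jet a b c (chart ξ lam f) = if (a, b, c) = t then 1 else 0 := by
  obtain ⟨i, j, k⟩ := t
  obtain ⟨φ, hs, hφ⟩ := exists_dual_jet i j k
  obtain ⟨f, hf⟩ := exists_chart_eq ξ lam φ hs
  exact ⟨f, fun a b c => by rw [hf, hφ]⟩

/-- A choice of elements of the principal series dual to the derivatives at the identity. -/
def dual (ξ : Fin 3 → ZMod 2) (lam : Fin 3 → ℂ) (t : ℕ × ℕ × ℕ) : principalSeries ξ lam :=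
  (exists_dual ξ lam t).choose

theorem jet_dual (t : ℕ × ℕ × ℕ) (a b c : ℕ) :
    jet a b c (chart ξ lam (dual ξ lam t)) = if (a, b, c) = t then 1 else 0 :=
  (exists_dual ξ lam t).choose_spec a b c

/-- The coefficients of the operator `T` at the identity. -/
def coeff (T : principalSeries ξ lam →ₗ[ℂ] principalSeries η ν) (t : ℕ × ℕ × ℕ) : ℂ :=
  (T (dual ξ lam t) : GL (Fin 2) ℝ → ℂ) 1

/-- Finite order says that the functional vanishes on the common kernel of finitely many jets, so it
lies in their span; testing on dual elements identifies the coefficients. -/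
theorem DSBO.exists_expansion (hT : T ∈ DSBO 2 ξ lam η ν) :
    ∃ S : Finset (ℕ × ℕ × ℕ), (∀ t ∉ S, coeff T t = 0) ∧ ∀ f : principalSeries ξ lam,
      (T f : GL (Fin 2) ℝ → ℂ) 1 =
        ∑ t ∈ S, coeff T t * jet t.1 t.2.1 t.2.2 (chart ξ lam f) := by
  obtain ⟨M, hM⟩ := DSBO.exists_order hT
  -- A box containing all multi-indices of total order at most `M`.
  set S : Finset (ℕ × ℕ × ℕ) :=
    Finset.range (M + 1) ×ˢ (Finset.range (M + 1) ×ˢ Finset.range (M + 1)) with hS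
  let L : S → principalSeries ξ lam →ₗ[ℂ] ℂ := fun t =>
    jet t.1.1 t.1.2.1 t.1.2.2 ∘ₗ chart ξ lam
  let K : principalSeries ξ lam →ₗ[ℂ] ℂ :=
    { toFun := fun f => (T f : GL (Fin 2) ℝ → ℂ) 1
      map_add' := fun f g => by rw [map_add]; rfl
      map_smul' := fun c f => by rw [map_smul]; rfl }
  have hker : ⨅ i, (L i).ker ≤ K.ker := by
    intro f hf
    rw [Submodule.mem_iInf] at hf
    refine hM f fun p hp => iteratedFDeriv_eq_zero_of_jet_eq_zero p _ fun a b c habc => ?_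
    exact hf ⟨(a, b, c), by simp only [hS, Finset.mem_product, Finset.mem_range]; omega⟩
  obtain ⟨c, hc⟩ := (Submodule.mem_span_range_iff_exists_fun ℂ).1
    (mem_span_of_iInf_ker_le_ker hker)
  have hexp : ∀ f : principalSeries ξ lam, (T f : GL (Fin 2) ℝ → ℂ) 1 =
      ∑ t : S, c t * jet t.1.1 t.1.2.1 t.1.2.2 (chart ξ lam f) := fun f => by
    have := LinearMap.congr_fun hc f
    simp only [LinearMap.sum_apply, LinearMap.smul_apply, smul_eq_mul] at this
    exact this.symm
  have hcoeff : ∀ t : S, coeff T t = c t := fun t => by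
    rw [coeff, hexp, Finset.sum_eq_single t]
    · rw [jet_dual, if_pos rfl, mul_one]
    · intro s _ hs
      rw [jet_dual, if_neg, mul_zero]
      exact fun h => hs (Subtype.ext h)
    · simp
  refine ⟨S, fun t ht => ?_, fun f => ?_⟩
  · rw [coeff, hexp]
    refine Finset.sum_eq_zero fun s _ => ?_
    rw [jet_dual, if_neg, mul_zero]
    rintro rfl
    exact ht s.2
  · rw [hexp, ← Finset.sum_coe_sort S]
    exact Finset.sum_congr rfl fun t _ => by rw [hcoeff]

theorem DSBO.eq_zero_of_coeff (hT : T ∈ DSBO 2 ξ lam η ν) (h : ∀ t, coeff T t = 0) : T = 0 := by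
  obtain ⟨S, -, hexp⟩ := DSBO.exists_expansion hT
  ext f g
  rw [DSBO.apply_eq hT, hexp]
  simp [h]

/-! ### Relations on the coefficients from the upper triangular subgroup -/

theorem apply_mul_diagH (f : principalSeries η ν) (g : GL (Fin 2) ℝ) (p q : ℝ) (h : p * q ≠ 0) :
    (f : GL (Fin 2) ℝ → ℂ) (g * diagH p q h) =
      signedPow (η 0) (-ν 0 - 1 / 2) p * signedPow (η 1) (-ν 1 + 1 / 2) q *
        (f : GL (Fin 2) ℝ → ℂ) g := by
  rw [f.2.2 g (diagH p q h), Fin.prod_univ_two]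
  · rw [coe_diagH, rho_two.1, rho_two.2]
    simp
  · intro i j hij
    rw [coe_diagH]
    fin_cases i <;> fin_cases j <;> simp at hij ⊢

theorem apply_mul_unipH (f : principalSeries η ν) (g : GL (Fin 2) ℝ) (s : ℝ) :
    (f : GL (Fin 2) ℝ → ℂ) (g * unipH s) = (f : GL (Fin 2) ℝ → ℂ) g := by
  rw [f.2.2 g (unipH s), Fin.prod_univ_two]
  · rw [coe_unipH]
    simp [signedPow_one]
  · intro i j hij
    rw [coe_unipH]
    fin_cases i <;> fin_cases j <;> simp at hij ⊢

/-- Diagonal matrices rescale the chart, so every jet is an eigenvector. A jet that occurs must have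
the weight prescribed by the target. -/
theorem DSBO.coeff_diagH (hT : T ∈ DSBO 2 ξ lam η ν) (a b c : ℕ) (p q : ℝ) (h : p * q ≠ 0)
    (hne : coeff T (a, b, c) ≠ 0) :
    signedPow (ξ 0) (-lam 0 - 1) p * signedPow (ξ 1) (-lam 1) q *
        (((q / p : ℝ) : ℂ) ^ a * ((q⁻¹ : ℝ) : ℂ) ^ b * ((p⁻¹ : ℝ) : ℂ) ^ c) =
      signedPow (η 0) (-ν 0 - 1 / 2) p * signedPow (η 1) (-ν 1 + 1 / 2) q := by
  obtain ⟨S, hS, hexp⟩ := DSBO.exists_expansion hT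
  set f := dual ξ lam (a, b, c)
  have h1 : (T f : GL (Fin 2) ℝ → ℂ) (diagH p q h) =
      signedPow (η 0) (-ν 0 - 1 / 2) p * signedPow (η 1) (-ν 1 + 1 / 2) q * coeff T (a, b, c) := by
    rw [← one_mul (diagH p q h), apply_mul_diagH]; rfl
  have h2 : (T f : GL (Fin 2) ℝ → ℂ) (diagH p q h) =
      signedPow (ξ 0) (-lam 0 - 1) p * signedPow (ξ 1) (-lam 1) q *
        (((q / p : ℝ) : ℂ) ^ a * ((q⁻¹ : ℝ) : ℂ) ^ b * ((p⁻¹ : ℝ) : ℂ) ^ c) *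
          coeff T (a, b, c) := by
    rw [DSBO.apply_eq hT, hexp, chart_translate_diagH, Finset.sum_eq_single (a, b, c)]
    · rw [map_smul, jet_scaleFun, jet_dual, if_pos rfl, smul_eq_mul]; ring
    · rintro ⟨i, j, k⟩ _ hs
      rw [map_smul, jet_scaleFun, jet_dual, if_neg hs]
      simp
    · intro ht
      exact absurd (hS _ ht) hne
  exact mul_right_cancel₀ hne (h2.symm.trans h1)

/-- The exponent is recovered as the derivative at `x = 1`. -/
theorem cpow_exponent_injective {α β : ℂ}
    (h : ∀ x : ℝ, 0 < x → (x : ℂ) ^ α = (x : ℂ) ^ β) : α = β := by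
  have hd : ∀ γ : ℂ, HasDerivAt (fun x : ℝ => (x : ℂ) ^ γ) γ 1 := fun γ => by
    have := HasDerivAt.scomp (1 : ℝ) (g₁ := fun w : ℂ => w ^ γ) (h := fun t : ℝ => (t : ℂ))
      (Complex.hasStrictDerivAt_cpow_const (c := γ) (by simp)).hasDerivAt
      (hasDerivAt_id (1 : ℝ)).ofReal_comp
    simpa [Function.comp_def] using this
  refine (hd α).unique ((hd β).congr_of_eventuallyEq ?_)
  filter_upwards [lt_mem_nhds (one_pos : (0 : ℝ) < 1)] with x hx
  exact h x hx

theorem natCast_zmod_two_eq_of_neg_one_pow {m n : ℕ} (h : (-1 : ℂ) ^ m = (-1) ^ n) :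
    (m : ZMod 2) = n := by
  rw [ZMod.natCast_eq_natCast_iff']
  rw [neg_one_pow_eq_pow_mod_two, neg_one_pow_eq_pow_mod_two n] at h
  rcases Nat.mod_two_eq_zero_or_one m with hm | hm <;>
    rcases Nat.mod_two_eq_zero_or_one n with hn | hn <;> rw [hm, hn] at h ⊢ <;> norm_num at h

theorem ofReal_inv_pow_eq_cpow (x : ℝ) (n : ℕ) :
    ((x⁻¹ : ℝ) : ℂ) ^ n = (x : ℂ) ^ (-(n : ℂ)) := by
  rw [Complex.cpow_neg, Complex.cpow_natCast, Complex.ofReal_inv, inv_pow]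

/-- Positive diagonal entries determine the complex exponents and entries `-1` the parities. -/
theorem DSBO.coeff_ne_zero (hT : T ∈ DSBO 2 ξ lam η ν) {a b c : ℕ}
    (hne : coeff T (a, b, c) ≠ 0) :
    ν 0 - lam 0 - 1 / 2 = ((a + c : ℕ) : ℂ) ∧
    ν 0 + ν 1 - lam 0 - lam 1 - 1 = ((b + c : ℕ) : ℂ) ∧
    η 0 = ξ 0 + (a + c : ℕ) ∧ η 1 = ξ 1 + ((a + c : ℕ) + (b + c : ℕ)) := by
  have key := DSBO.coeff_diagH hT a b c
  have e1 : -lam 0 - 1 + (-(a : ℂ)) + (-(c : ℂ)) = -ν 0 - 1 / 2 := by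
    refine cpow_exponent_injective fun x hx => ?_
    have hc : (x : ℂ) ≠ 0 := by exact_mod_cast hx.ne'
    have := key x 1 (by simpa using hx.ne') hne
    simp only [signedPow_one, mul_one, one_div, inv_one, Complex.ofReal_one, one_pow,
      signedPow_of_pos _ _ hx, ofReal_inv_pow_eq_cpow] at this
    rw [Complex.cpow_add _ _ hc, Complex.cpow_add _ _ hc, mul_assoc, this]
    simp
  have e2 : -lam 1 + (a : ℂ) + (-(b : ℂ)) = -ν 1 + 1 / 2 := by
    refine cpow_exponent_injective fun x hx => ?_
    have hc : (x : ℂ) ≠ 0 := by exact_mod_cast hx.ne'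
    have := key 1 x (by simpa using hx.ne') hne
    simp only [signedPow_one, mul_one, one_mul, div_one, inv_one, Complex.ofReal_one, one_pow,
      signedPow_of_pos _ _ hx, ofReal_inv_pow_eq_cpow] at this
    rw [Complex.cpow_add _ _ hc, Complex.cpow_add _ _ hc, Complex.cpow_natCast, mul_assoc, this]
  have e3 : ((ξ 0).val + a + c : ℕ) = ((η 0).val : ZMod 2) := by
    refine natCast_zmod_two_eq_of_neg_one_pow ?_
    have := key (-1) 1 (by simp) hne
    norm_num [signedPow_one, signedPow_neg_one] at this
    rw [pow_add, pow_add, mul_assoc]; exact this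
  have e4 : ((ξ 1).val + a + b : ℕ) = ((η 1).val : ZMod 2) := by
    refine natCast_zmod_two_eq_of_neg_one_pow ?_
    have := key 1 (-1) (by simp) hne
    norm_num [signedPow_one, signedPow_neg_one] at this
    rw [pow_add, pow_add, mul_assoc]; exact this
  -- Needed because the parity of `a + b` is written as that of `(a + c) + (b + c)`.
  have two : (2 : ZMod 2) = 0 := rfl
  push_cast [ZMod.natCast_val, ZMod.cast_id] at e3 e4
  refine ⟨?_, ?_, ?_, ?_⟩
  · push_cast; linear_combination e1
  · push_cast; linear_combination e1 + e2
  · push_cast; linear_combination -e3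
  · push_cast; linear_combination -e4 - (c : ZMod 2) * two

/-- The character of the target is trivial on unipotent matrices, so `T f` is constant along `unipH
s`; this is its derivative at `s = 0`. -/
theorem DSBO.sum_coeff_unipotentField (hT : T ∈ DSBO 2 ξ lam η ν) {S : Finset (ℕ × ℕ × ℕ)}
    (hexp : ∀ f : principalSeries ξ lam, (T f : GL (Fin 2) ℝ → ℂ) 1 =
        ∑ t ∈ S, coeff T t * jet t.1 t.2.1 t.2.2 (chart ξ lam f)) (f : principalSeries ξ lam) :
    ∑ t ∈ S, coeff T t * jet t.1 t.2.1 t.2.2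
      (unipotentField (lam 1 - lam 0 - 1) (chart ξ lam f)) = 0 := by
  have h1 : HasDerivAt (fun s => ∑ t ∈ S, coeff T t *
      jet t.1 t.2.1 t.2.2 (chart ξ lam (translate ξ lam (unipH s) f)))
      (∑ t ∈ S, coeff T t * jet t.1 t.2.1 t.2.2
        (unipotentField (lam 1 - lam 0 - 1) (chart ξ lam (translate ξ lam (unipH 0) f)))) 0 :=
    HasDerivAt.fun_sum fun t _ =>
      (hasDerivAt_jet_chart_translate_unipH f t.1 t.2.1 t.2.2 0).const_mul _
  have h2 : (fun s => ∑ t ∈ S, coeff T t *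
      jet t.1 t.2.1 t.2.2 (chart ξ lam (translate ξ lam (unipH s) f))) =
      fun _ => (T f : GL (Fin 2) ℝ → ℂ) 1 := by
    funext s
    rw [← hexp, ← DSBO.apply_eq hT, ← one_mul (unipH s), apply_mul_unipH]
  rw [h2, unipH_zero, translate_one] at h1
  exact h1.unique (hasDerivAt_const _ _)

/-- Testing on the element dual to `(i, j + 1, k)` leaves the only two jets whose image under the
field involves this index. -/
theorem DSBO.coeff_recurrence (hT : T ∈ DSBO 2 ξ lam η ν) (i j k : ℕ) :
    (i + 1) * (lam 1 - lam 0 - 1 - i + (j + 1) - k) * coeff T (i + 1, j + 1, k) =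
      (k + 1) * coeff T (i, j, k + 1) := by
  obtain ⟨S, hS, hexp⟩ := DSBO.exists_expansion hT
  have key := DSBO.sum_coeff_unipotentField hT hexp (dual ξ lam (i, j + 1, k))
  have hterm : ∀ t : ℕ × ℕ × ℕ, coeff T t * jet t.1 t.2.1 t.2.2
      (unipotentField (lam 1 - lam 0 - 1) (chart ξ lam (dual ξ lam (i, j + 1, k)))) =
      (if t = (i + 1, j + 1, k) then
        (i + 1) * (lam 1 - lam 0 - 1 - i + (j + 1) - k) * coeff T (i + 1, j + 1, k) else 0) -
      (if t = (i, j, k + 1) then (k + 1) * coeff T (i, j, k + 1) else 0) := by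
    rintro ⟨a, b, c⟩
    dsimp only
    rw [jet_unipotentField, jet_dual, jet_dual, mul_sub]
    congr 1
    · rcases a with _ | a
      · simp
      · by_cases h : (a + 1, b, c) = (i + 1, j + 1, k)
        · simp only [Prod.mk.injEq, Nat.add_right_cancel_iff] at h
          obtain ⟨rfl, rfl, rfl⟩ := h
          rw [if_pos (by simp), if_pos rfl]; push_cast; ring
        · rw [if_neg h, if_neg (fun h' => h ?_)]
          · simp
          · simp only [Prod.mk.injEq] at h' ⊢; omega
    · rcases c with _ | c
      · simp
      · by_cases h : (a, b, c + 1) = (i, j, k + 1)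
        · simp only [Prod.mk.injEq, Nat.add_right_cancel_iff] at h
          obtain ⟨rfl, rfl, rfl⟩ := h
          rw [if_pos (by simp), if_pos rfl]; push_cast; ring
        · rw [if_neg h, if_neg (fun h' => h ?_)]
          · simp
          · simp only [Prod.mk.injEq] at h' ⊢; omega
  simp only [hterm, Finset.sum_sub_distrib, Finset.sum_ite_eq'] at key
  have h1 : (if (i + 1, j + 1, k) ∈ S then (i + 1) * (lam 1 - lam 0 - 1 - i + (j + 1) - k) *
      coeff T (i + 1, j + 1, k) else 0) =
      (i + 1) * (lam 1 - lam 0 - 1 - i + (j + 1) - k) * coeff T (i + 1, j + 1, k) := by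
    split_ifs with h
    · rfl
    · rw [hS _ h, mul_zero]
  have h2 : (if (i, j, k + 1) ∈ S then (k + 1) * coeff T (i, j, k + 1) else 0) =
      (k + 1) * coeff T (i, j, k + 1) := by
    split_ifs with h
    · rfl
    · rw [hS _ h, mul_zero]
  rw [h1, h2] at key
  exact sub_eq_zero.1 key

/-- When the test index has no `y`-derivative, the second term of the recurrence is absent, because
it always carries at least one. -/
theorem DSBO.coeff_boundary (hT : T ∈ DSBO 2 ξ lam η ν) (i k : ℕ) :
    (lam 1 - lam 0 - 1 - i - k) * coeff T (i + 1, 0, k) = 0 := by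
  obtain ⟨S, hS, hexp⟩ := DSBO.exists_expansion hT
  have key := DSBO.sum_coeff_unipotentField hT hexp (dual ξ lam (i, 0, k))
  rw [Finset.sum_eq_single (i + 1, 0, k)] at key
  · dsimp only at key
    rw [jet_unipotentField, jet_dual, jet_dual, if_pos (by simp), if_neg (by simp)] at key
    have hi : ((i + 1 : ℕ) : ℂ) ≠ 0 := by exact_mod_cast i.succ_ne_zero
    refine (mul_eq_zero.1 (?_ : ((i + 1 : ℕ) : ℂ) * _ = 0)).resolve_left hi
    push_cast at key ⊢
    linear_combination key
  · rintro ⟨a, b, c⟩ _ h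
    dsimp only
    rw [jet_unipotentField, jet_dual, jet_dual, if_neg (c := (a, b + 1, c - 1) = _) (by simp)]
    rcases a with _ | a
    · simp
    · rw [if_neg]
      · simp
      · intro h'
        apply h
        simp only [Prod.mk.injEq] at h' ⊢; omega
  · intro h
    rw [hS _ h, zero_mul]

/-- The factor `k + 1` in the recurrence never vanishes, so a nonzero coefficient forces its
predecessor to be nonzero, down to `z`-order zero. -/
theorem DSBO.coeff_ne_zero_of_coeff_ne_zero (hT : T ∈ DSBO 2 ξ lam η ν) {i j k : ℕ}
    (h : coeff T (i, j, k) ≠ 0) : coeff T (i + k, j + k, 0) ≠ 0 := by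
  induction k generalizing i j with
  | zero => exact h
  | succ k ih =>
    have hr := DSBO.coeff_recurrence hT i j k
    have h1 : coeff T (i + 1, j + 1, k) ≠ 0 := by
      intro h0
      rw [h0, mul_zero] at hr
      have hk : ((k + 1 : ℕ) : ℂ) ≠ 0 := by exact_mod_cast k.succ_ne_zero
      push_cast at hk
      exact mul_ne_zero hk h hr.symm
    have := ih h1
    rwa [show i + 1 + k = i + (k + 1) by ring, show j + 1 + k = j + (k + 1) by ring] at this

/-- Otherwise no factor of the recurrence vanishes up to `j = n₂`, so the last coefficient is
nonzero, and the boundary relation there gives the excluded case `k₀ = n₂`. -/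
theorem DSBO.le_or_exists (hT : T ∈ DSBO 2 ξ lam η ν) {n₁ n₂ : ℕ}
    (h : coeff T (n₁, n₂, 0) ≠ 0) :
    n₁ ≤ n₂ ∨ ∃ k₀ : ℕ, k₀ ≤ n₂ ∧ lam 0 - lam 1 + n₁ - n₂ + k₀ = 0 := by
  by_contra! H
  obtain ⟨hlt, hA⟩ := H
  have step : ∀ j ≤ n₂, coeff T (n₁ - j, n₂ - j, j) ≠ 0 := by
    intro j
    induction j with
    | zero => intro _; exact h
    | succ j ih =>
      intro hj
      have h1 := ih (by omega)
      have hr := DSBO.coeff_recurrence hT (n₁ - (j + 1)) (n₂ - (j + 1)) j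
      rw [show n₁ - (j + 1) + 1 = n₁ - j by omega, show n₂ - (j + 1) + 1 = n₂ - j by omega] at hr
      intro h0
      rw [h0, mul_zero] at hr
      have e1 : ((n₁ - (j + 1) : ℕ) : ℂ) = n₁ - (j + 1) := by
        rw [Nat.cast_sub (by omega)]; push_cast; ring
      have e2 : ((n₂ - (j + 1) : ℕ) : ℂ) = n₂ - (j + 1) := by
        rw [Nat.cast_sub (by omega)]; push_cast; ring
      have hn : ((n₁ - (j + 1) : ℕ) : ℂ) + 1 ≠ 0 := by
        exact_mod_cast (n₁ - (j + 1)).succ_ne_zero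
      refine mul_ne_zero (mul_ne_zero hn ?_) h1 hr
      -- The bracket of the recurrence equals `-(λ₁ - λ₂ + n₁ - n₂ + j)`, so its vanishing would
      -- make `k₀ = j` a solution.
      intro h2
      refine hA j (by omega) ?_
      rw [e1, e2] at h2
      linear_combination -h2
  have hlast := step n₂ le_rfl
  have hb := DSBO.coeff_boundary hT (n₁ - n₂ - 1) n₂
  rw [show n₁ - n₂ - 1 + 1 = n₁ - n₂ by omega] at hb
  rw [Nat.sub_self] at hlast
  have h2 := (mul_eq_zero.1 hb).resolve_right hlast
  refine hA n₂ le_rfl ?_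
  have e1 : ((n₁ - n₂ - 1 : ℕ) : ℂ) = n₁ - n₂ - 1 := by
    rw [Nat.cast_sub (by omega), Nat.cast_sub (by omega)]; push_cast; ring
  rw [e1] at h2
  linear_combination -h2

theorem DSBO.eq_zero_of_not_admissible (hT : T ∈ DSBO 2 ξ lam η ν)
    (h : ¬ ∃ n₁ n₂ : ℕ, Admissible ξ lam η ν n₁ n₂) : T = 0 := by
  refine DSBO.eq_zero_of_coeff hT fun ⟨a, b, c⟩ => ?_
  by_contra hne
  obtain ⟨h1, h2, h3, h4⟩ := DSBO.coeff_ne_zero hT hne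
  exact h ⟨a + c, b + c, h1, h2,
    DSBO.le_or_exists hT (DSBO.coeff_ne_zero_of_coeff_ne_zero hT hne), h3, h4⟩

theorem DSBO.eq_zero_of_coeff_eq_zero (hT : T ∈ DSBO 2 ξ lam η ν) {n₁ n₂ : ℕ}
    (hn : Admissible ξ lam η ν n₁ n₂) (h : coeff T (n₁, n₂, 0) = 0) : T = 0 := by
  refine DSBO.eq_zero_of_coeff hT fun ⟨a, b, c⟩ => ?_
  by_contra hne
  obtain ⟨h1, h2, -, -⟩ := DSBO.coeff_ne_zero hT hne
  have e1 : a + c = n₁ := by exact_mod_cast h1.symm.trans hn.1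
  have e2 : b + c = n₂ := by exact_mod_cast h2.symm.trans hn.2.1
  have := DSBO.coeff_ne_zero_of_coeff_ne_zero hT hne
  rw [e1, e2] at this
  exact this h

end Structure

/-! ### The operator with the given distribution kernel -/

section Kernel

variable {ξ : Fin 3 → ZMod 2} {lam : Fin 3 → ℂ} {η : Fin 2 → ZMod 2} {ν : Fin 2 → ℂ}

theorem signedPow_add (ε ε' : ZMod 2) (s s' : ℂ) {x : ℝ} (hx : x ≠ 0) :
    signedPow (ε + ε') (s + s') x = signedPow ε s x * signedPow ε' s' x := by
  have ha : ((|x| : ℝ) : ℂ) ≠ 0 := by simpa using hx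
  have hs : (((SignType.sign x : ℝ) : ℂ)) ^ (ε + ε').val =
      (((SignType.sign x : ℝ) : ℂ)) ^ ε.val * (((SignType.sign x : ℝ) : ℂ)) ^ ε'.val := by
    rcases lt_or_gt_of_ne hx with h | h
    · rw [sign_neg h]
      have hv : (ε + ε').val % 2 = (ε.val + ε'.val) % 2 := by revert ε ε'; decide
      simp only [SignType.coe_neg_one, Complex.ofReal_neg, Complex.ofReal_one]
      rw [← pow_add, neg_one_pow_eq_pow_mod_two, hv, ← neg_one_pow_eq_pow_mod_two]
    · simp [sign_pos h]
  rw [signedPow, signedPow, signedPow, hs, Complex.cpow_add _ _ ha]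
  ring

theorem signedPow_natCast (n : ℕ) {x : ℝ} (hx : x ≠ 0) :
    signedPow (n : ZMod 2) (n : ℂ) x = (x : ℂ) ^ n := by
  induction n with
  | zero => simp [signedPow]
  | succ n ih =>
    have h1 : signedPow 1 1 x = (x : ℂ) := by
      have : (((SignType.sign x : ℝ) : ℂ)) * ((|x| : ℝ) : ℂ) = (x : ℂ) := by
        rw [← Complex.ofReal_mul, sign_mul_abs]
      simpa [signedPow, ZMod.val_one] using this
    push_cast
    rw [signedPow_add _ _ _ _ hx, ih, h1, pow_succ]

/-- In `ℤ/2ℤ` the class of `n` is its own negative, so the same parity serves the inverse power. -/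
theorem signedPow_neg_natCast (n : ℕ) {x : ℝ} (hx : x ≠ 0) :
    signedPow (n : ZMod 2) (-(n : ℂ)) x = ((x : ℂ) ^ n)⁻¹ := by
  have h := signedPow_add (n : ZMod 2) (n : ZMod 2) (n : ℂ) (-(n : ℂ)) hx
  rw [signedPow_natCast n hx, CharTwo.add_self_eq_zero, add_neg_cancel] at h
  have h1 : signedPow 0 0 x = 1 := by simp [signedPow]
  rw [h1] at h
  exact eq_inv_of_mul_eq_one_right h.symm

/-- The coefficients of the distribution kernel with respect to the derivatives at the origin. -/
def kernelCoeff (lam : Fin 3 → ℂ) (n₁ n₂ j : ℕ) : ℂ :=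
  (-1) ^ (n₁ + n₂) * (ascPochhammer ℂ j).eval (-(n₁ : ℂ)) *
    (ascPochhammer ℂ j).eval (lam 0 - lam 1 + n₁ - n₂) / (j.factorial : ℂ)

/-- The distribution kernel as a functional on smooth functions. -/
def kernelFun (lam : Fin 3 → ℂ) (n₁ n₂ : ℕ) : smoothFun →ₗ[ℂ] ℂ :=
  ∑ j ∈ Finset.range (min n₁ n₂ + 1), kernelCoeff lam n₁ n₂ j • jet (n₁ - j) (n₂ - j) j

theorem kernelFun_apply (n₁ n₂ : ℕ) (φ : smoothFun) :
    kernelFun lam n₁ n₂ φ = ∑ j ∈ Finset.range (min n₁ n₂ + 1),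
      kernelCoeff lam n₁ n₂ j * jet (n₁ - j) (n₂ - j) j φ := by
  simp [kernelFun, LinearMap.sum_apply]

/-- The sign `(-1)^j` of the kernel combines with the sign `(-1)^(n₁+n₂-j)` of the delta
derivatives, leaving a sign independent of `j`. -/
theorem kernelTwo_eq_kernelFun (n₁ n₂ : ℕ) (φ : smoothFun) :
    kernelTwo lam n₁ n₂ (fun x y z => (φ : ℝ × ℝ × ℝ → ℂ) (x, y, z)) =
      kernelFun lam n₁ n₂ φ := by
  rw [kernelFun_apply, kernelTwo]
  refine Finset.sum_congr rfl fun j hj => ?_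
  have hj' : j ≤ min n₁ n₂ := Nat.lt_succ_iff.1 (Finset.mem_range.1 hj)
  have e : (-1 : ℂ) ^ (n₁ + n₂) = (-1) ^ j * (-1) ^ (n₁ - j + (n₂ - j) + j) := by
    rw [← pow_add]; congr 1; omega
  rw [deltaDeriv_eq_jet, kernelCoeff, e]
  ring

theorem kernelCoeff_succ (n₁ n₂ j : ℕ) :
    (j + 1) * kernelCoeff lam n₁ n₂ (j + 1) =
      (-n₁ + j) * (lam 0 - lam 1 + n₁ - n₂ + j) * kernelCoeff lam n₁ n₂ j := by
  have hf : (j.factorial : ℂ) ≠ 0 := by exact_mod_cast j.factorial_ne_zero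
  have hj : (j : ℂ) + 1 ≠ 0 := by exact_mod_cast j.succ_ne_zero
  simp only [kernelCoeff, ascPochhammer_succ_eval, Nat.factorial_succ]
  push_cast
  field_simp

/-- The recurrence makes the sum telescope: after `N` terms only one boundary term with coefficient
`N c_N` survives. At `N = 0` the factor `N` hides the truncated subtractions. -/
theorem kernelFun_unipotentField (n₁ n₂ : ℕ)
    (h : n₁ ≤ n₂ ∨ ∃ k₀ : ℕ, k₀ ≤ n₂ ∧ lam 0 - lam 1 + n₁ - n₂ + k₀ = 0) (φ : smoothFun) :
    kernelFun lam n₁ n₂ (unipotentField (lam 1 - lam 0 - 1) φ) = 0 := by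
  have key : ∀ N ≤ min n₁ n₂ + 1, ∑ j ∈ Finset.range N, kernelCoeff lam n₁ n₂ j *
      jet (n₁ - j) (n₂ - j) j (unipotentField (lam 1 - lam 0 - 1) φ) =
      N * kernelCoeff lam n₁ n₂ N * jet (n₁ - N) (n₂ - (N - 1)) (N - 1) φ := by
    intro N
    induction N with
    | zero => intro _; simp
    | succ N ih =>
      intro hN
      have e1 : ((n₁ - N : ℕ) : ℂ) = n₁ - N := Nat.cast_sub (by omega)
      have e2 : ((n₂ - N : ℕ) : ℂ) = n₂ - N := Nat.cast_sub (by omega)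
      have e3 : (N : ℂ) * jet (n₁ - N) (n₂ - N + 1) (N - 1) φ =
          N * jet (n₁ - N) (n₂ - (N - 1)) (N - 1) φ := by
        rcases N with _ | N
        · simp
        · rw [show n₂ - (N + 1) + 1 = n₂ - (N + 1 - 1) by omega]
      rw [Finset.sum_range_succ, ih (by omega), jet_unipotentField, Nat.cast_succ,
        kernelCoeff_succ, e1, e2, e3, Nat.add_sub_cancel, ← Nat.sub_sub]
      ring
  rw [kernelFun_apply, key _ le_rfl]
  -- The first coefficient beyond the sum vanishes: `(-n₁)_j` contains a zero factor if `n₁ ≤ n₂`,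
  -- and otherwise the other Pochhammer symbol contains the factor with index `k₀`.
  have hz : kernelCoeff lam n₁ n₂ (min n₁ n₂ + 1) = 0 := by
    by_cases hle : n₁ ≤ n₂
    · rw [min_eq_left hle, kernelCoeff, ascPochhammer_succ_eval, neg_add_cancel]
      simp
    · obtain ⟨k, hk, hk0⟩ := h.resolve_left hle
      rw [min_eq_right (by omega), kernelCoeff]
      have : (ascPochhammer ℂ (n₂ + 1)).eval (lam 0 - lam 1 + n₁ - n₂) = 0 := by
        exact (ascPochhammer_eval_eq_zero_iff _ _).2
          ⟨k, Nat.lt_succ_of_le hk, by linear_combination hk0⟩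
      rw [this]; simp
  rw [hz]; simp

/-- All terms have the same weight: raising `j` trades one `x`- and one `y`-derivative, of total
weight `p⁻¹`, for one `z`-derivative. -/
theorem kernelFun_scaleFun (n₁ n₂ : ℕ) {p q : ℝ} (hp : p ≠ 0) (hq : q ≠ 0) (φ : smoothFun) :
    kernelFun lam n₁ n₂ (scaleFun (q / p) q⁻¹ p⁻¹ φ) =
      ((p : ℂ) ^ n₁)⁻¹ * (q : ℂ) ^ n₁ * ((q : ℂ) ^ n₂)⁻¹ * kernelFun lam n₁ n₂ φ := by
  have hp' : (p : ℂ) ≠ 0 := by exact_mod_cast hp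
  have hq' : (q : ℂ) ≠ 0 := by exact_mod_cast hq
  rw [kernelFun_apply, kernelFun_apply, Finset.mul_sum]
  refine Finset.sum_congr rfl fun j hj => ?_
  have hj' : j ≤ min n₁ n₂ := Nat.lt_succ_iff.1 (Finset.mem_range.1 hj)
  obtain ⟨k, rfl⟩ : ∃ k, n₁ = k + j := ⟨n₁ - j, by omega⟩
  obtain ⟨l, rfl⟩ : ∃ l, n₂ = l + j := ⟨n₂ - j, by omega⟩
  rw [jet_scaleFun, Nat.add_sub_cancel, Nat.add_sub_cancel]
  push_cast
  rw [pow_add, pow_add, pow_add, div_pow, inv_pow, inv_pow]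
  field_simp

theorem IsSmooth.sum {n : ℕ} {ι : Type*} (s : Finset ι) {f : ι → GL (Fin n) ℝ → ℂ}
    (h : ∀ i ∈ s, IsSmooth (f i)) : IsSmooth (∑ i ∈ s, f i) := by
  classical
  induction s using Finset.induction_on with
  | empty => simpa using isSmooth_zero
  | insert i s hi ih =>
    rw [Finset.sum_insert hi]
    exact (h i (Finset.mem_insert_self _ _)).add
      (ih fun j hj => h j (Finset.mem_insert_of_mem hj))

theorem isSmooth_kernelFun (n₁ n₂ : ℕ) (f : principalSeries ξ lam) :
    IsSmooth (fun h => kernelFun lam n₁ n₂ (chart ξ lam (translate ξ lam h f))) := by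
  have e : (fun h => kernelFun lam n₁ n₂ (chart ξ lam (translate ξ lam h f))) =
      ∑ j ∈ Finset.range (min n₁ n₂ + 1), kernelCoeff lam n₁ n₂ j •
        fun h => jet (n₁ - j) (n₂ - j) j (chart ξ lam (translate ξ lam h f)) := by
    funext h
    rw [kernelFun_apply, Finset.sum_apply]
    rfl
  rw [e]
  exact IsSmooth.sum _ fun j _ => (isSmooth_jet_chart_translate _ _ _ f).const_smul _

/-- The kernel annihilates the vector field applied to every translate, so the derivative vanishes
for all `s`, not only at `0`. -/
theorem kernelFun_translate_unipH {n₁ n₂ : ℕ}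
    (h : n₁ ≤ n₂ ∨ ∃ k₀ : ℕ, k₀ ≤ n₂ ∧ lam 0 - lam 1 + n₁ - n₂ + k₀ = 0)
    (f : principalSeries ξ lam) (s : ℝ) :
    kernelFun lam n₁ n₂ (chart ξ lam (translate ξ lam (unipH s) f)) =
      kernelFun lam n₁ n₂ (chart ξ lam f) := by
  have hd : ∀ s, HasDerivAt
      (fun s => kernelFun lam n₁ n₂ (chart ξ lam (translate ξ lam (unipH s) f))) 0 s := fun s => by
    rw [← kernelFun_unipotentField n₁ n₂ h (chart ξ lam (translate ξ lam (unipH s) f))]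
    simp only [kernelFun_apply]
    exact HasDerivAt.fun_sum fun j _ =>
      (hasDerivAt_jet_chart_translate_unipH f (n₁ - j) (n₂ - j) j s).const_mul _
  have := is_const_of_deriv_eq_zero (fun s => (hd s).differentiableAt) (fun s => (hd s).deriv) s 0
  rw [this, unipH_zero, translate_one]

theorem kernelFun_translate_diagH {n₁ n₂ : ℕ} (hn : Admissible ξ lam η ν n₁ n₂)
    (f : principalSeries ξ lam) (p q : ℝ) (h : p * q ≠ 0) :
    kernelFun lam n₁ n₂ (chart ξ lam (translate ξ lam (diagH p q h) f)) =
      signedPow (η 0) (-ν 0 - rho 2 0) p * signedPow (η 1) (-ν 1 - rho 2 1) q *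
        kernelFun lam n₁ n₂ (chart ξ lam f) := by
  have hp := left_ne_zero_of_mul h
  have hq := right_ne_zero_of_mul h
  obtain ⟨h1, h2, -, h3, h4⟩ := hn
  rw [chart_translate_diagH, map_smul, kernelFun_scaleFun n₁ n₂ hp hq, rho_two.1, rho_two.2, h3, h4,
    show -ν 0 - 1 / 2 = -lam 0 - 1 + (-(n₁ : ℂ)) by linear_combination -h1,
    show -ν 1 - -(1 / 2) = -lam 1 + (n₁ + -(n₂ : ℂ)) by linear_combination h1 - h2,
    signedPow_add _ _ _ _ hp, signedPow_add _ _ _ _ hq, signedPow_add _ _ _ _ hq,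
    signedPow_natCast _ hq, signedPow_neg_natCast _ hp, signedPow_neg_natCast _ hq, smul_eq_mul]
  ring

theorem eq_unipH_mul_diagH (p : GL (Fin 2) ℝ) (hp : IsUpper p) :
    ∃ h : (p : Matrix (Fin 2) (Fin 2) ℝ) 0 0 * (p : Matrix (Fin 2) (Fin 2) ℝ) 1 1 ≠ 0,
      p = unipH ((p : Matrix (Fin 2) (Fin 2) ℝ) 0 1 / (p : Matrix (Fin 2) (Fin 2) ℝ) 1 1) *
        diagH _ _ h := by
  have h10 : (p : Matrix (Fin 2) (Fin 2) ℝ) 1 0 = 0 := hp 1 0 (by decide)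
  have hd : (p : Matrix (Fin 2) (Fin 2) ℝ) 0 0 * (p : Matrix (Fin 2) (Fin 2) ℝ) 1 1 ≠ 0 := by
    have := det_ne_zero p
    rwa [Matrix.det_fin_two, h10, mul_zero, sub_zero] at this
  refine ⟨hd, Units.ext ?_⟩
  rw [Units.val_mul, coe_unipH, coe_diagH, Matrix.mul_fin_two]
  ext i j
  fin_cases i <;> fin_cases j <;> simp [h10, div_mul_cancel₀ _ (right_ne_zero_of_mul hd)]

/-- The differential symmetry breaking operator given by the distribution kernel. -/
def kernelOperator {n₁ n₂ : ℕ} (hn : Admissible ξ lam η ν n₁ n₂) :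
    principalSeries ξ lam →ₗ[ℂ] principalSeries η ν where
  toFun f := ⟨fun h => kernelFun lam n₁ n₂ (chart ξ lam (translate ξ lam h f)),
    isSmooth_kernelFun n₁ n₂ f, fun h p hp => by
      obtain ⟨hd, e⟩ := eq_unipH_mul_diagH p hp
      have ht : translate ξ lam (h * p) f = translate ξ lam (diagH _ _ hd)
          (translate ξ lam (unipH ((p : Matrix (Fin 2) (Fin 2) ℝ) 0 1 /
            (p : Matrix (Fin 2) (Fin 2) ℝ) 1 1)) (translate ξ lam h f)) := by
        rw [← translate_mul, ← translate_mul, ← e]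
      dsimp only
      rw [Fin.prod_univ_two, ht, kernelFun_translate_diagH hn,
        kernelFun_translate_unipH hn.2.2.1]⟩
  map_add' f g := by
    ext h
    change kernelFun lam n₁ n₂ (chart ξ lam (translate ξ lam h (f + g))) = _
    rw [map_add, map_add, map_add]; rfl
  map_smul' c f := by
    ext h
    change kernelFun lam n₁ n₂ (chart ξ lam (translate ξ lam h (c • f))) = _
    rw [map_smul, map_smul, map_smul]; rfl

theorem kernelOperator_apply {n₁ n₂ : ℕ} (hn : Admissible ξ lam η ν n₁ n₂)
    (f : principalSeries ξ lam) (h : GL (Fin 2) ℝ) :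
    (kernelOperator hn f : GL (Fin 2) ℝ → ℂ) h =
      kernelFun lam n₁ n₂ (chart ξ lam (translate ξ lam h f)) := rfl

theorem hasKernel_kernelOperator {n₁ n₂ : ℕ} (hn : Admissible ξ lam η ν n₁ n₂) :
    HasKernel 2 (kernelOperator hn) (kernelTwo lam n₁ n₂) := by
  intro f h
  rw [kernelOperator_apply, ← kernelTwo_eq_kernelFun, basePoint_two_two, mul_one]
  simp only [chart_translate_apply]

theorem nbar_inv (x y z : ℝ) : (nbar x y z)⁻¹ = nbar (-x) (-y) (x * y - z) := by
  refine inv_eq_of_mul_eq_one_right (Units.ext ?_)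
  rw [Units.val_mul, coe_nbar, coe_nbar]
  ext i j
  fin_cases i <;> fin_cases j <;> (simp [Matrix.mul_apply, Fin.sum_univ_three]; try ring)

theorem continuous_nbar : Continuous fun u : ℝ × ℝ × ℝ => nbar u.1 u.2.1 u.2.2 := by
  have key : Continuous fun u : ℝ × ℝ × ℝ =>
      (nbar u.1 u.2.1 u.2.2 : Matrix (Fin 3) (Fin 3) ℝ) := by
    refine continuous_matrix fun i j => ?_
    simp only [coe_nbar]
    fin_cases i <;> fin_cases j <;> (simp; fun_prop)
  refine Units.continuous_iff.2 ⟨key, ?_⟩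
  simp only [nbar_inv]
  exact key.comp (f := fun u : ℝ × ℝ × ℝ => (-u.1, -u.2.1, u.1 * u.2.1 - u.2.2)) (by fun_prop)

theorem continuous_embedH : Continuous (embedH 2) := by
  have key : Continuous fun h : GL (Fin 2) ℝ => (embedH 2 h : Matrix (Fin 3) (Fin 3) ℝ) := by
    simp only [coe_embedH]
    refine continuous_matrix fun i j => ?_
    have ce := continuous_coe_entry (n := 2)
    fin_cases i <;> fin_cases j <;> simp [embedMatrix, ce] <;> exact continuous_const
  refine Units.continuous_iff.2 ⟨key, ?_⟩
  simp only [← map_inv]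
  exact key.comp continuous_inv

theorem kernelOperator_mem {n₁ n₂ : ℕ} (hn : Admissible ξ lam η ν n₁ n₂) :
    kernelOperator hn ∈ DSBO 2 ξ lam η ν := by
  refine ⟨fun k => ?_, fun f h hh => ?_⟩
  · refine LinearMap.ext fun f => Subtype.ext (funext fun h => ?_)
    change kernelFun lam n₁ n₂ (chart ξ lam (translate ξ lam h (leftRegular ξ lam (embedH 2 k) f))) =
      kernelFun lam n₁ n₂ (chart ξ lam (translate ξ lam (k⁻¹ * h) f))
    rw [translate_mul]
    simp only [translate, map_inv, inv_inv]
  · rw [basePoint_two_two, mul_one]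
    by_contra hne
    refine absurd hh (notMem_tsupport_iff_eventuallyEq.2 ?_)
    have hev := notMem_tsupport_iff_eventuallyEq.1 hne
    -- For each `k` near `h`, `f` vanishes on a whole neighbourhood of `embedH 2 k`; this kills the
    -- germ of the translated chart and hence all its jets.
    filter_upwards [continuous_embedH.continuousAt.eventually hev.eventually_nhds] with k hk
    have hc : Filter.Tendsto (fun u : ℝ × ℝ × ℝ => embedH 2 k * nbar u.1 u.2.1 u.2.2) (nhds 0)
        (nhds (embedH 2 k)) := by
      have h1 : nbar 0 0 0 = 1 := by
        refine Units.ext ?_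
        rw [coe_nbar]
        ext i j
        fin_cases i <;> fin_cases j <;> simp
      have h2 : Filter.Tendsto (fun u : ℝ × ℝ × ℝ => embedH 2 k * nbar u.1 u.2.1 u.2.2) (nhds 0)
          (nhds (embedH 2 k * nbar (0 : ℝ × ℝ × ℝ).1 (0 : ℝ × ℝ × ℝ).2.1 (0 : ℝ × ℝ × ℝ).2.2)) :=
        (continuous_const.mul continuous_nbar).tendsto 0
      have h3 : embedH 2 k * nbar (0 : ℝ × ℝ × ℝ).1 (0 : ℝ × ℝ × ℝ).2.1 (0 : ℝ × ℝ × ℝ).2.2 =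
          embedH 2 k := by
        change embedH 2 k * nbar 0 0 0 = _
        rw [h1, mul_one]
      rwa [h3] at h2
    have h0 : (chart ξ lam (translate ξ lam k f) : ℝ × ℝ × ℝ → ℂ) =ᶠ[nhds 0] 0 := by
      filter_upwards [hc.eventually hk] with u hu
      obtain ⟨x, y, z⟩ := u
      rw [chart_translate_apply]
      exact hu
    rw [kernelOperator_apply, kernelFun_apply]
    refine Finset.sum_eq_zero fun j _ => ?_
    rw [jet_eq_zero_of_eventuallyEq _ _ _ h0, mul_zero]

theorem coeff_kernelOperator_ne_zero {n₁ n₂ : ℕ} (hn : Admissible ξ lam η ν n₁ n₂) :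
    coeff (kernelOperator hn) (n₁, n₂, 0) ≠ 0 := by
  rw [coeff, kernelOperator_apply, translate_one, kernelFun_apply,
    Finset.sum_eq_single 0]
  · rw [jet_dual, if_pos (by simp)]
    simp [kernelCoeff]
  · intro j _ hj
    rw [jet_dual, if_neg, mul_zero]
    simp [hj]
  · simp

/-- Subtracting the right multiple removes the coefficient at `(n₁, n₂, 0)`, which controls all the
others. -/
theorem DSBO.eq_smul_kernelOperator {n₁ n₂ : ℕ} (hn : Admissible ξ lam η ν n₁ n₂)
    {T : principalSeries ξ lam →ₗ[ℂ] principalSeries η ν} (hT : T ∈ DSBO 2 ξ lam η ν) :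
    (coeff T (n₁, n₂, 0) / coeff (kernelOperator hn) (n₁, n₂, 0)) • kernelOperator hn = T := by
  set c := coeff T (n₁, n₂, 0) / coeff (kernelOperator hn) (n₁, n₂, 0) with hc
  have hmem : T + (-c) • kernelOperator hn ∈ DSBO 2 ξ lam η ν :=
    (DSBO 2 ξ lam η ν).add_mem hT ((DSBO 2 ξ lam η ν).smul_mem _ (kernelOperator_mem hn))
  have h0 : T + (-c) • kernelOperator hn = 0 := by
    refine DSBO.eq_zero_of_coeff_eq_zero hmem hn ?_
    change coeff T (n₁, n₂, 0) + -c * coeff (kernelOperator hn) (n₁, n₂, 0) = 0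
    rw [hc, neg_mul, div_mul_cancel₀ _ (coeff_kernelOperator_ne_zero hn), add_neg_cancel]
  refine LinearMap.ext fun f => Subtype.ext (funext fun g => ?_)
  have h1 : (T f : GL (Fin 2) ℝ → ℂ) g + -c * (kernelOperator hn f : GL (Fin 2) ℝ → ℂ) g = 0 :=
    congrFun (congrArg Subtype.val (LinearMap.congr_fun h0 f)) g
  change c * (kernelOperator hn f : GL (Fin 2) ℝ → ℂ) g = (T f : GL (Fin 2) ℝ → ℂ) g
  linear_combination -h1

/-- For admissible parameters the differential symmetry breaking operators form a line. -/
def lineEquivDSBO {n₁ n₂ : ℕ} (hn : Admissible ξ lam η ν n₁ n₂) : ℂ ≃ₗ[ℂ] DSBO 2 ξ lam η ν :=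
  LinearEquiv.ofBijective
    (LinearMap.toSpanSingleton ℂ (DSBO 2 ξ lam η ν) ⟨kernelOperator hn, kernelOperator_mem hn⟩) (by
      refine ⟨fun c d hcd => ?_, fun T => ⟨_, Subtype.ext (DSBO.eq_smul_kernelOperator hn T.2)⟩⟩
      have h : c • kernelOperator hn = d • kernelOperator hn := congrArg Subtype.val hcd
      have h' : c * coeff (kernelOperator hn) (n₁, n₂, 0) =
          d * coeff (kernelOperator hn) (n₁, n₂, 0) := congrArg (fun T => coeff T (n₁, n₂, 0)) h
      exact mul_right_cancel₀ (coeff_kernelOperator_ne_zero hn) h')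

theorem coe_lineEquivDSBO_one {n₁ n₂ : ℕ} (hn : Admissible ξ lam η ν n₁ n₂) :
    (lineEquivDSBO hn 1 : principalSeries ξ lam →ₗ[ℂ] principalSeries η ν) = kernelOperator hn :=
  one_smul ℂ (kernelOperator hn)

end Kernel

end GLBranching

end

theorem proposition5p5 (ξ : Fin 3 → ZMod 2) (lam : Fin 3 → ℂ) (η : Fin 2 → ZMod 2)
    (ν : Fin 2 → ℂ) :
    (∀ n₁ n₂ : ℕ, GLBranching.Admissible ξ lam η ν n₁ n₂ →
      Module.rank ℂ (GLBranching.DSBO 2 ξ lam η ν) = 1 ∧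
      ∃ b : Module.Basis (Fin 1) ℂ (GLBranching.DSBO 2 ξ lam η ν),
        GLBranching.HasKernel 2
          (b 0 : GLBranching.principalSeries ξ lam →ₗ[ℂ] GLBranching.principalSeries η ν)
          (GLBranching.kernelTwo lam n₁ n₂)) ∧
    ((¬ ∃ n₁ n₂ : ℕ, GLBranching.Admissible ξ lam η ν n₁ n₂) →
      Module.rank ℂ (GLBranching.DSBO 2 ξ lam η ν) = 0) := by
  refine ⟨fun n₁ n₂ hn => ?_, fun h => ?_⟩
  · refine ⟨(GLBranching.lineEquivDSBO hn).rank_eq.symm.trans (Module.rank_self ℂ),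
      (Module.Basis.singleton (Fin 1) ℂ).map (GLBranching.lineEquivDSBO hn), ?_⟩
    rw [Module.Basis.map_apply, Module.Basis.singleton_apply, GLBranching.coe_lineEquivDSBO_one]
    exact GLBranching.hasKernel_kernelOperator hn
  · have : Subsingleton (GLBranching.DSBO 2 ξ lam η ν) :=
      ⟨fun S T => Subtype.ext ((GLBranching.DSBO.eq_zero_of_not_admissible S.2 h).trans
        (GLBranching.DSBO.eq_zero_of_not_admissible T.2 h).symm)⟩
    exact rank_subsingleton' ℂ _
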